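/- Let $\Sigma$ be a finite alphabet with at least two letters and let $\$\notin\Sigma$. For a language $L\subseteq(\Sigma\cup\{\$\})^*$ put $\mathrm{pref}(L)=\{w : wx\in L \text{ for some } x\}$, $\mathrm{suff}(L)=\{w : xw\in L \text{ for some } x\}$ and $\mathrm{inf}(L)=\{w : xwy\in L \text{ for some } x,y\}$, where $x,y$ range over $(\Sigma\cup\{\$\})^*$. For $\varrho\in\{\mathrm{pref},\mathrm{suff},\mathrm{inf}\}$, call $L$ $\varrho$-marked-dense if $\$\Sigma^*\$\subseteq\varrho(L)$. A one-way nondeterministic $k$-counter machine has finitely many states, a one-way read-only input followed by a right end-marker $\lhd$, and $k$ counters holding non-negative integers, all initially $0$. Depending on the state, the scanned symbol and which counters are zero, a transition changes the state, keeps the head in place or moves it one symbol to the right, and adds $-1$, $0$ or $+1$ to each counter (never $-1$ to a counter that is zero). A word $w$ is accepted if some computation on $w\lhd$ reaches an accepting state with exactly $\lhd$ left to read. The machine is $l$-reversal-bounded if in every accepting computation each counter alternates between increasing and decreasing at most $l$ times, and it is deterministic if its transition relation is a partial function. $\mathrm{NCM}(k,l)$ denotes the family of languages accepted by $l$-reversal-bounded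 $k$-counter machines, and $\mathrm{DCM}(k,l)$ the family of those accepted by deterministic such machines; languages in these families are given as inputs by such machines (over the alphabet $\Sigma\cup\{\$\}$). 1. For each $\varrho\in\{\mathrm{suff},\mathrm{inf},\mathrm{pref}\}$, it is undecidable, given $L\in\mathrm{NCM}(1,1)$, whether $L$ is $\varrho$-marked-dense. 2. For each $\varrho\in\{\mathrm{suff},\mathrm{inf}\}$, it is undecidable, given $L\in\mathrm{DCM}(1,3)$, whether $L$ is $\varrho$-marked-dense. 3. For each $\varrho\in\{\mathrm{suff},\mathrm{inf}\}$, it is undecidable, given $L\in\mathrm{DCM}(2,1)$, whether $L$ is $\varrho$-marked-dense. -/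

import Mathlib

namespace CounterLang

universe u

/-! Words and operations on languages -/

/-- The set of all prefixes of words of `L`. -/
def pref {A : Type u} (L : Language A) : Language A := {w | ∃ x : List A, w ++ x ∈ L}

/-- The set of all suffixes of words of `L`. -/
def suff {A : Type u} (L : Language A) : Language A := {w | ∃ x : List A, x ++ w ∈ L}

/-- The set of all infixes of words of `L`. -/
def infx {A : Type u} (L : Language A) : Language A :=
  {w | ∃ x y : List A, x ++ w ++ y ∈ L}

/-- The alphabet `Σ ∪ {$}` where `$` is a new letter: `none` is `$`, `some a` is the letter `a`. -/
abbrev Marked (α : Type u) : Type u := Option α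

/-- The language `$ Σ* $` over `Σ ∪ {$}`. -/
def markedWords (α : Type u) : Language (Marked α) :=
  {u | ∃ w : List α, u = [none] ++ w.map some ++ [none]}

/-- `L` is `ϱ`-marked-dense: `$ Σ* $ ⊆ ϱ(L)`. -/
def MarkedDense {α : Type u} (ϱ : Language (Marked α) → Language (Marked α))
    (L : Language (Marked α)) : Prop :=
  markedWords α ≤ ϱ L

/-! One-way multicounter machines -/

/-- One element `(tgt, move, change) ∈ δ(src, read, positive)` of a transition relation with `k`
counters. The symbol read is an input letter `some a` or the right end-marker `none`;
`positive i` tells whether counter `i` is nonzero; `moveRight = false` means that the head stays;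
each counter changes by `-1`, `0` or `+1`. -/
structure Transition (k : ℕ) (A : Type u) where
  src : ℕ
  read : Option A
  positive : Fin k → Bool
  tgt : ℕ
  moveRight : Bool
  change : Fin k → SignType

/-- A one-way `k`-counter machine with input alphabet `A`, as a finite object. States are natural
numbers; the state set is the finite set of those that occur in the description. -/
structure CounterMachine (k : ℕ) (A : Type u) where
  start : ℕ
  accept : List ℕ
  trans : List (Transition k A)

/-- A configuration: current state, rest of the input tape (ending in the end-marker), counters. -/
structure Config (k : ℕ) (A : Type u) where
  state : ℕ
  tape : List (Option A)
  counters : Fin k → ℕ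

namespace CounterMachine

variable {k : ℕ} {A : Type u}

/-- No transition decrements a counter that tests as zero. -/
def WellFormed (M : CounterMachine k A) : Prop :=
  ∀ t ∈ M.trans, ∀ i, t.positive i = false → 0 ≤ t.change i

/-- The transition relation is a partial function. -/
def Deterministic (M : CounterMachine k A) : Prop :=
  ∀ t ∈ M.trans, ∀ t' ∈ M.trans,
    t.src = t'.src → t.read = t'.read → t.positive = t'.positive → t = t'

/-- `M` moves in one step from `x` to `y` by the transition `t`. -/
def Step (M : CounterMachine k A) (x : Config k A) (t : Transition k A) (y : Config k A) : Prop :=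
  t ∈ M.trans ∧ x.state = t.src ∧ x.tape.head? = some t.read ∧
    (∀ i, t.positive i = true ↔ 0 < x.counters i) ∧
    y.state = t.tgt ∧
    y.tape = (if t.moveRight = true then x.tape.tail else x.tape) ∧
    ∀ i, (y.counters i : ℤ) = (x.counters i : ℤ) + (t.change i : ℤ)

/-- `M.Run x ts y`: the sequence `ts` of transitions is a computation of `M` from `x` to `y`. -/
inductive Run (M : CounterMachine k A) :
    Config k A → List (Transition k A) → Config k A → Prop
  | nil (x : Config k A) : Run M x [] x
  | cons {x y z : Config k A} {t : Transition k A} {ts : List (Transition k A)} :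
      M.Step x t y → Run M y ts z → Run M x (t :: ts) z

/-- The initial configuration on the input `w`. -/
def init (M : CounterMachine k A) (w : List A) : Config k A :=
  ⟨M.start, w.map some ++ [none], fun _ => 0⟩

/-- `ts` is an accepting computation of `M` on `w`: it ends in an accepting state with exactly the
end-marker left on the tape, the counters being arbitrary. -/
def AcceptingRun (M : CounterMachine k A) (w : List A) (ts : List (Transition k A)) : Prop :=
  ∃ y : Config k A, M.Run (M.init w) ts y ∧ y.state ∈ M.accept ∧ y.tape = [none]

/-- The language `L(M)`. -/
def language (M : CounterMachine k A) : Language A := {w | ∃ ts, M.AcceptingRun w ts}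

end CounterMachine

/-- The number of alternations between increasing and decreasing in a sequence of changes:
steps without change are dropped, and the switches between `+1` and `-1` are counted. -/
def reversals (l : List SignType) : ℕ :=
  ((l.filter (fun s => s ≠ 0)).destutter (fun s t => s ≠ t)).length - 1

namespace CounterMachine

variable {k : ℕ} {A : Type u}

/-- In every accepting computation, every counter makes at most `l` reversals. -/
def ReversalBounded (l : ℕ) (M : CounterMachine k A) : Prop :=
  ∀ w ts, M.AcceptingRun w ts → ∀ i, reversals (ts.map fun t => t.change i) ≤ l

/-- `M` is a machine of the class `NCM(k,l)`. -/
def IsNCM (l : ℕ) (M : CounterMachine k A) : Prop := M.WellFormed ∧ M.ReversalBounded l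

/-- `M` is a machine of the class `DCM(k,l)`. -/
def IsDCM (l : ℕ) (M : CounterMachine k A) : Prop := M.IsNCM l ∧ M.Deterministic

end CounterMachine

/-! Machines as inputs of algorithms -/

instance : Primcodable SignType := Primcodable.ofEquiv (Fin 3) SignType.fin3Equiv.toEquiv

/-- A transition as a tuple. -/
def Transition.equivProd (k : ℕ) (A : Type u) :
    Transition k A ≃ ℕ × Option A × (Fin k → Bool) × ℕ × Bool × (Fin k → SignType) where
  toFun t := (t.src, t.read, t.positive, t.tgt, t.moveRight, t.change)
  invFun t := ⟨t.1, t.2.1, t.2.2.1, t.2.2.2.1, t.2.2.2.2.1, t.2.2.2.2.2⟩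
  left_inv _ := rfl
  right_inv _ := rfl

instance {k : ℕ} {A : Type u} [Primcodable A] : Primcodable (Transition k A) :=
  Primcodable.ofEquiv _ (Transition.equivProd k A)

/-- A machine as a tuple. -/
def CounterMachine.equivProd (k : ℕ) (A : Type u) :
    CounterMachine k A ≃ ℕ × List ℕ × List (Transition k A) where
  toFun M := (M.start, M.accept, M.trans)
  invFun M := ⟨M.1, M.2.1, M.2.2⟩
  left_inv _ := rfl
  right_inv _ := rfl

instance {k : ℕ} {A : Type u} [Primcodable A] : Primcodable (CounterMachine k A) :=
  Primcodable.ofEquiv _ (CounterMachine.equivProd k A)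

/-- The property `P` is decidable for inputs from the class `D`: some algorithm halts on every input
in `D` and answers there whether `P` holds. Nothing is required on inputs outside `D`. -/
def DecidableOn {β : Type u} [Primcodable β] (D P : β → Prop) : Prop :=
  ∃ f : β →. Bool, Partrec f ∧ ∀ b, D b → ∃ v ∈ f b, (v = true ↔ P b)

end CounterLang

/-! All three parts reduce from the halting problem of one recurrence `z (n+2) = coeff i j * (z n /
m) + const i j` started at `0, N`. Fix two letters `a ≠ b`. A word `w` is read as the list of
lengths of its `a`-blocks, that is, as a purported halting history. A `Checker` accepts words `a^n $
w $` in which it finds a fault: for `n = 0` the list does not begin with `0, N`; for `n + 1` the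
list fails at block `n`. Finding such a fault is a local task: count the quotient of one block by
`m` into a counter, keep its residue and that of the next block in the state, and compare the third
block with the required length. Hence every `$w$` is covered iff every `w` is faulty iff the
recurrence does not halt (`forall_exists_detects_iff`).

The prefix `a^n` makes the search deterministic, at the price of a position counter. If this is a
separate counter, each counter makes one reversal; if it is reused for the comparison, there are
three. A nondeterministic machine guesses the block instead, needs no prefix, and so also handles
`pref`.

Such recurrences are Turing complete (`Encoding.Describes.halts_iff`). Two successive members hold
the two halves of the tape as base-`m` numbers, and the later one also holds the control state; a
Turing step is two steps of the recurrence, one for each stack. Mathlib's compilation of partial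
recursive functions to Turing machines then gives a recurrence with undecidable halting
(`exists_undecidable_recurrence`), and the checker is primitive recursive in `N`
(`primrec_machine`). -/

namespace CounterLang

/-! ### Bounding reversals by phases -/

section Reversals

variable {k : ℕ} {A : Type*}

/-- Here `b` is the last nonzero change and `P` a phase of matching parity. A change of the opposite
sign needs a phase of the other parity, hence a strictly larger one, so at most `l - P` alternations
remain. -/
theorem CounterMachine.Run.length_destutter'_le {M : CounterMachine k A} {i : Fin k}
    {ph : ℕ → ℕ} {l : ℕ}
    (h : ∀ t ∈ M.trans, ph t.src ≤ ph t.tgt ∧ ph t.tgt ≤ l ∧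
      (t.change i = 1 → Even (ph t.tgt)) ∧ (t.change i = -1 → Odd (ph t.tgt)))
    {x y : Config k A} {ts : List (Transition k A)} (hr : M.Run x ts y) :
    ∀ (b : SignType) (P : ℕ), (b = 1 ∧ Even P ∨ b = -1 ∧ Odd P) → P ≤ ph x.state → P ≤ l →
      (((ts.map fun t => t.change i).filter (fun s => s ≠ 0)).destutter'
        (fun s t => s ≠ t) b).length ≤ 1 + (l - P) := by
  induction hr with
  | nil x => intro b P _ _ _; simp
  | @cons x y z t ts hs _ ih =>
    intro b P hb hP hl
    obtain ⟨h1, h2, h3, h4⟩ := h t hs.1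
    have hx : x.state = t.src := hs.2.1
    have hy : y.state = t.tgt := hs.2.2.2.2.1
    rw [hx] at hP
    rw [hy] at ih
    by_cases h0 : t.change i = 0
    · simpa [h0] using ih b P hb (by omega) hl
    · have hc : t.change i = 1 ∧ Even (ph t.tgt) ∨ t.change i = -1 ∧ Odd (ph t.tgt) := by
        rcases ht : t.change i with _ | _ | _
        · exact absurd ht h0
        · exact Or.inr ⟨rfl, h4 ht⟩
        · exact Or.inl ⟨rfl, h3 ht⟩
      by_cases hbc : b = t.change i
      · simpa [h0, hbc] using ih (t.change i) P (hbc ▸ hb) (by omega) hl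
      · have hlt : P < ph t.tgt := by
          refine lt_of_le_of_ne (by omega) fun he => ?_
          rw [← he] at hc
          rcases hb with ⟨hb, hb'⟩ | ⟨hb, hb'⟩ <;> rcases hc with ⟨hc, hc'⟩ | ⟨hc, hc'⟩
          · exact hbc (hb.trans hc.symm)
          · exact Nat.not_even_iff_odd.2 hc' hb'
          · exact Nat.not_even_iff_odd.2 hb' hc'
          · exact hbc (hb.trans hc.symm)
        have := ih (t.change i) (ph t.tgt) hc le_rfl h2
        simp [h0, hbc] at this ⊢
        omega

/-- A machine whose states carry phases that never decrease, a counter being incremented in even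
phases only and decremented in odd phases only, reverses that counter at most as often as the
phase changes. -/
theorem CounterMachine.Run.reversals_le {M : CounterMachine k A} {i : Fin k} {ph : ℕ → ℕ} {l : ℕ}
    (h : ∀ t ∈ M.trans, ph t.src ≤ ph t.tgt ∧ ph t.tgt ≤ l ∧
      (t.change i = 1 → Even (ph t.tgt)) ∧ (t.change i = -1 → Odd (ph t.tgt)))
    {x y : Config k A} {ts : List (Transition k A)} (hr : M.Run x ts y) :
    reversals (ts.map fun t => t.change i) ≤ l := by
  induction hr with
  | nil x => simp [reversals]
  | @cons x y z t ts hs hr' ih =>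
    obtain ⟨h1, h2, h3, h4⟩ := h t hs.1
    have hy : y.state = t.tgt := hs.2.2.2.2.1
    by_cases h0 : t.change i = 0
    · simpa [h0, reversals] using ih
    · have hc : t.change i = 1 ∧ Even (ph t.tgt) ∨ t.change i = -1 ∧ Odd (ph t.tgt) := by
        rcases ht : t.change i with _ | _ | _
        · exact absurd ht h0
        · exact Or.inr ⟨rfl, h4 ht⟩
        · exact Or.inl ⟨rfl, h3 ht⟩
      have := hr'.length_destutter'_le h (t.change i) (ph t.tgt) hc (by rw [hy]) h2
      simp [reversals, h0, List.destutter_cons'] at this ⊢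
      omega

end Reversals

/-! ### Machines given by a rule on abstract states -/

section OfRule

variable {k : ℕ} {A S : Type*}

/-- `x` starts an accepting computation. -/
def CounterMachine.Accepts (M : CounterMachine k A) (x : Config k A) : Prop :=
  ∃ ts y, M.Run x ts y ∧ y.state ∈ M.accept ∧ y.tape = [none]

theorem CounterMachine.accepts_iff {M : CounterMachine k A} {x : Config k A} :
    M.Accepts x ↔ (x.state ∈ M.accept ∧ x.tape = [none]) ∨ ∃ t y, M.Step x t y ∧ M.Accepts y := by
  constructor
  · rintro ⟨ts, y, hr, hy⟩
    cases hr with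
    | nil => exact Or.inl hy
    | cons hs hr => exact Or.inr ⟨_, _, hs, _, _, hr, hy⟩
  · rintro (h | ⟨t, y, hs, ts, z, hr, hz⟩)
    · exact ⟨[], x, .nil x, h⟩
    · exact ⟨t :: ts, z, .cons hs hr, hz⟩

/-- The counters after a change. -/
def updCounters (c : Fin k → ℕ) (ch : Fin k → SignType) : Fin k → ℕ :=
  fun i => ((c i : ℤ) + (ch i : ℤ)).toNat

@[simp] theorem updCounters_zero (c : Fin k → ℕ) : updCounters c 0 = c := by
  funext i; simp [updCounters]

@[simp] theorem updCounters_single_one (c : Fin k → ℕ) (p : Fin k) :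
    updCounters c (Pi.single p 1) = Function.update c p (c p + 1) := by
  funext i
  by_cases h : i = p
  · subst h; simp [updCounters]
  · simp [updCounters, h]

@[simp] theorem updCounters_single_neg_one (c : Fin k → ℕ) (p : Fin k) :
    updCounters c (Pi.single p (-1)) = Function.update c p (c p - 1) := by
  funext i
  by_cases h : i = p
  · subst h; simp [updCounters]; omega
  · simp [updCounters, h]

/-- The transitions out of the state `s` prescribed by a rule that lists, for each state, symbol and
zero test, the possible new states, head moves and counter changes. -/
noncomputable def transOf [Fintype A] (code : S → ℕ)
    (δ : S → Option A → (Fin k → Bool) → List (S × Bool × (Fin k → SignType))) (s : S) :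
    List (Transition k A) :=
  (Finset.univ : Finset (Option A × (Fin k → Bool))).toList.flatMap fun rp =>
    (δ s rp.1 rp.2).map fun o => ⟨code s, rp.1, rp.2, code o.1, o.2.1, o.2.2⟩

/-- The machine given by a rule on a list of abstract states, which are numbered by `code`. -/
noncomputable def machineOf [Fintype A] (code : S → ℕ)
    (δ : S → Option A → (Fin k → Bool) → List (S × Bool × (Fin k → SignType)))
    (start final : S) (states : List S) : CounterMachine k A where
  start := code start
  accept := [code final]
  trans := states.flatMap (transOf code δ)

variable [Fintype A] {code : S → ℕ}
  {δ : S → Option A → (Fin k → Bool) → List (S × Bool × (Fin k → SignType))}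
  {start final : S} {states : List S}

theorem mem_trans_machineOf {t : Transition k A} :
    t ∈ (machineOf code δ start final states).trans ↔
      ∃ s ∈ states, ∃ o ∈ δ s t.read t.positive,
        t = ⟨code s, t.read, t.positive, code o.1, o.2.1, o.2.2⟩ := by
  simp only [machineOf, transOf, List.mem_flatMap, List.mem_map, Finset.mem_toList,
    Finset.mem_univ, true_and]
  constructor
  · rintro ⟨s, hs, rp, o, ho, rfl⟩
    exact ⟨s, hs, o, ho, rfl⟩
  · rintro ⟨s, hs, o, ho, h⟩
    exact ⟨s, hs, (t.read, t.positive), o, ho, h.symm⟩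

theorem wellFormed_machineOf
    (h : ∀ s r p, ∀ o ∈ δ s r p, ∀ i, p i = false → 0 ≤ o.2.2 i) :
    (machineOf code δ start final states).WellFormed := by
  intro t ht i hi
  obtain ⟨s, -, o, ho, e⟩ := mem_trans_machineOf.1 ht
  have := h s _ _ o ho i hi
  rw [e]; exact this

theorem deterministic_machineOf (hc : Function.Injective code)
    (h : ∀ s r p, (δ s r p).length ≤ 1) :
    (machineOf code δ start final states).Deterministic := by
  intro t ht t' ht' h1 h2 h3
  obtain ⟨s, -, o, ho, e⟩ := mem_trans_machineOf.1 ht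
  obtain ⟨s', -, o', ho', e'⟩ := mem_trans_machineOf.1 ht'
  have hs : s = s' := hc (by rw [e, e'] at h1; exact h1)
  subst hs
  rw [← h2, ← h3] at ho'
  have hl := h s t.read t.positive
  have : o = o' := by
    match hd : δ s t.read t.positive with
    | [] => simp [hd] at ho
    | [b] => rw [hd] at ho ho'; simp at ho ho'; rw [ho, ho']
    | _ :: _ :: _ => simp [hd] at hl
  rw [e, e', h2, h3, this]

theorem reversalBounded_machineOf {l : ℕ} (hc : Function.Injective code) (ph : Fin k → S → ℕ)
    (h : ∀ i s r p, ∀ o ∈ δ s r p, ph i s ≤ ph i o.1 ∧ ph i o.1 ≤ l ∧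
      (o.2.2 i = 1 → Even (ph i o.1)) ∧ (o.2.2 i = -1 → Odd (ph i o.1))) :
    (machineOf code δ start final states).ReversalBounded l := by
  rintro w ts ⟨y, hr, -⟩ i
  -- Phases of abstract states are transported to their numbers; the default `0` is never met, since
  -- transitions only join coded states.
  refine hr.reversals_le (ph := Function.extend code (ph i) 0) fun t ht => ?_
  obtain ⟨s, -, o, ho, e⟩ := mem_trans_machineOf.1 ht
  have := h i s _ _ o ho
  rw [e]
  simpa [hc.extend_apply] using this

/-- Unfolds acceptance by one step, so that later proofs can go by induction on the tape without
mentioning runs or numbered states. -/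
theorem accepts_machineOf_iff (hc : Function.Injective code)
    (h : ∀ s r p, ∀ o ∈ δ s r p, ∀ i, p i = false → 0 ≤ o.2.2 i)
    {s : S} (hs : s ∈ states) (r : Option A) (tape : List (Option A)) (c : Fin k → ℕ) :
    (machineOf code δ start final states).Accepts ⟨code s, r :: tape, c⟩ ↔
      (s = final ∧ r :: tape = [none]) ∨
      ∃ o ∈ δ s r (fun i => decide (0 < c i)),
        (machineOf code δ start final states).Accepts
          ⟨code o.1, if o.2.1 = true then tape else r :: tape, updCounters c o.2.2⟩ := by
  rw [CounterMachine.accepts_iff]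
  refine or_congr (and_congr_left' ?_) ⟨?_, ?_⟩
  · simp [machineOf, hc.eq_iff]
  · rintro ⟨t, ⟨st, tp, cs⟩, ⟨ht, h1, h2, h3, h4, h5, h6⟩, ha⟩
    obtain ⟨s', -, o, ho, e⟩ := mem_trans_machineOf.1 ht
    simp only [List.head?_cons, Option.some.injEq, List.tail_cons] at h1 h2 h3 h4 h5 h6
    have hs' : s' = s := hc (by rw [h1, e])
    have hp : t.positive = fun i => decide (0 < c i) := by
      funext i; rw [Bool.eq_iff_iff]; simpa using h3 i
    subst hs'
    refine ⟨o, by rw [← hp, h2]; exact ho, ?_⟩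
    have hcs : cs = updCounters c o.2.2 := by
      funext i
      have := h6 i
      rw [e] at this
      simp only [updCounters]
      simp only at this
      omega
    rw [e] at h4 h5
    simp only at h4 h5
    rw [← h4, ← h5, ← hcs]
    exact ha
  · rintro ⟨o, ho, ha⟩
    refine ⟨⟨code s, r, fun i => decide (0 < c i), code o.1, o.2.1, o.2.2⟩, _,
      ⟨mem_trans_machineOf.2 ⟨s, hs, o, ho, rfl⟩, rfl, rfl, by simp, rfl, rfl, fun i => ?_⟩, ha⟩
    have := h s r _ o ho i
    simp only [decide_eq_false_iff_not, not_lt, Nat.le_zero] at this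
    simp only [updCounters]
    -- The truncation in `updCounters` loses nothing, because a zero counter is never decremented.
    apply Int.toNat_of_nonneg
    rcases Nat.eq_zero_or_pos (c i) with h0 | h0
    · have := this h0
      rcases ho' : o.2.2 i with _ | _ | _
      · simp
      · rw [ho'] at this; exact absurd this (by decide)
      · simp; omega
    · rcases ho' : o.2.2 i with _ | _ | _
      · simp
      · simp; omega
      · simp; omega

end OfRule

/-! ### Recurrences and halting histories -/

/-- A recurrence `z (n+2) = coeff i j * (z n / m) + const i j`, where `i` and `j` are the residues
modulo `m` of `z n` and `z (n+1)`, with a halting condition on `(i, j)`. -/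
structure Recurrence where
  m : ℕ
  m_pos : 0 < m
  coeff : ℕ → ℕ → ℕ
  const : ℕ → ℕ → ℕ
  halt : ℕ → ℕ → Prop

namespace Recurrence

/-- The value that follows `x` and `y`. -/
def next (R : Recurrence) (x y : ℕ) : ℕ :=
  R.coeff (x % R.m) (y % R.m) * (x / R.m) + R.const (x % R.m) (y % R.m)

/-- The sequence with given first two members. -/
def seq (R : Recurrence) (x y : ℕ) : ℕ → ℕ × ℕ
  | 0 => (x, y)
  | n + 1 => ((R.seq x y n).2, R.next (R.seq x y n).1 (R.seq x y n).2)

/-- The sequence reaches a halting pair. -/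
def Halts (R : Recurrence) (x y : ℕ) : Prop :=
  ∃ n, R.halt ((R.seq x y n).1 % R.m) ((R.seq x y n).2 % R.m)

/-- The continuation `l` of the sequence is not correct after a member with residue `i` and quotient
`s` and a member with residue `j`. -/
def Wrong (R : Recurrence) (i j s : ℕ) : List ℕ → Prop
  | [] => ¬ R.halt i j
  | z :: _ => z ≠ R.coeff i j * s + R.const i j

/-- The list is not correct at its beginning: the third member is not the one that follows the first
two, or it is missing and the first two members do not halt. -/
def Err (R : Recurrence) : List ℕ → Prop
  | x :: y :: l => R.Wrong (x % R.m) (y % R.m) (x / R.m) l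
  | _ => False

theorem seq_succ (R : Recurrence) (x y n : ℕ) :
    R.seq x y (n + 1) = R.seq y (R.next x y) n := by
  induction n with
  | zero => rfl
  | succ n ih => rw [seq, ih, seq]

/-- A list without local faults is an initial segment of the sequence whose last two members halt.
It may run past earlier halting pairs, since `Wrong` consults `halt` only at the end. -/
theorem exists_halting_list_iff (R : Recurrence) (x y : ℕ) :
    (∃ l, (∃ l', l = x :: y :: l') ∧ ∀ n, ¬ R.Err (l.drop n)) ↔ R.Halts x y := by
  constructor
  · rintro ⟨_, ⟨l, rfl⟩, h⟩
    induction l generalizing x y with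
    | nil => exact ⟨0, by simpa [Err, Wrong, seq] using h 0⟩
    | cons z l ih =>
      have hz : z = R.next x y := by simpa [Err, Wrong, next] using h 0
      subst hz
      obtain ⟨n, hn⟩ := ih y (R.next x y) fun n => by simpa using h (n + 1)
      refine ⟨n + 1, ?_⟩
      rwa [seq_succ]
  · rintro ⟨n, hn⟩
    induction n generalizing x y with
    | zero =>
      refine ⟨[x, y], ⟨[], rfl⟩, fun n => ?_⟩
      match n with
      | 0 => simpa [Err, Wrong, seq] using hn
      | 1 => simp [Err]
      | n + 2 => simp [Err]
    | succ n ih =>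
      rw [seq_succ] at hn
      obtain ⟨_, ⟨l, rfl⟩, hl⟩ := ih y (R.next x y) hn
      refine ⟨x :: y :: R.next x y :: l, ⟨_, rfl⟩, fun n => ?_⟩
      match n with
      | 0 => simp [Err, Wrong, next]
      | n + 1 => simpa using hl n

end Recurrence

/-! ### Words as lists of block lengths -/

section Blocks

variable {α : Type*} [DecidableEq α] (a : α)

/-- The length of the first block of letters `a` in a word. -/
def lead : List α → ℕ
  | [] => 0
  | x :: w => if x = a then lead w + 1 else 0

/-- The lengths of the further blocks; blocks are separated by single letters other than `a`. -/
def more : List α → List ℕ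
  | [] => []
  | x :: w => if x = a then more w else lead a w :: more w

/-- The lengths of all blocks. -/
def blocks (w : List α) : List ℕ := lead a w :: more a w

theorem blocks_cons_self (w : List α) : blocks a (a :: w) = (lead a w + 1) :: more a w := by
  simp [blocks, lead, more]

theorem blocks_cons_of_ne {b : α} (hb : b ≠ a) (w : List α) :
    blocks a (b :: w) = 0 :: blocks a w := by
  simp [blocks, lead, more, hb]

/-- The second letter of the alphabet is needed here, as a separator. -/
theorem exists_blocks_eq {b : α} (hb : b ≠ a) (z : ℕ) (l : List ℕ) :
    ∃ w, blocks a w = z :: l := by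
  induction l generalizing z with
  | nil =>
    induction z with
    | zero => exact ⟨[], rfl⟩
    | succ z ih =>
      obtain ⟨w, hw⟩ := ih
      refine ⟨a :: w, ?_⟩
      rw [blocks_cons_self]
      simpa [blocks] using hw
  | cons y l ih =>
    induction z with
    | zero =>
      obtain ⟨w, hw⟩ := ih y
      exact ⟨b :: w, by rw [blocks_cons_of_ne a hb, hw]⟩
    | succ z ih =>
      obtain ⟨w, hw⟩ := ih
      refine ⟨a :: w, ?_⟩
      rw [blocks_cons_self]
      simpa [blocks] using hw

end Blocks

/-! ### The checker and its reversal bounds -/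

/-- The parameters of the machine that looks for an error in a purported halting history: the
recurrence, the letter `unit` that the blocks consist of, the counter `position` that holds the
number of the block to check (`none` if this block is guessed), and the counter `compare` with
which the check is made. -/
structure Checker (k : ℕ) (α : Type*) where
  recur : Recurrence
  unit : α
  position : Option (Fin k)
  compare : Fin k

namespace Checker

/-- The states of a checker. -/
inductive State
  | start
  | skip
  | mid
  | count (i : ℕ)
  | resid (i j : ℕ)
  | remain (i j e : ℕ)
  | first
  | pre (j : ℕ)
  | acc
  | final

/-- A numbering of the states. -/
def State.code : State → ℕ
  | start => Nat.pair 0 0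
  | skip => Nat.pair 1 0
  | mid => Nat.pair 2 0
  | count i => Nat.pair 3 i
  | resid i j => Nat.pair 4 (Nat.pair i j)
  | remain i j e => Nat.pair 5 (Nat.pair i (Nat.pair j e))
  | first => Nat.pair 6 0
  | pre j => Nat.pair 7 j
  | acc => Nat.pair 8 0
  | final => Nat.pair 9 0

theorem State.code_injective : Function.Injective State.code := by
  intro s s' h
  cases s <;> cases s' <;> simp_all [State.code, Nat.pair_eq_pair]

open State

variable {k : ℕ} {α : Type*}

/-- The outcomes of the zero test of the position counter. -/
def test (C : Checker k α) (p : Fin k → Bool) : List Bool :=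
  match C.position with
  | some i => [p i]
  | none => [true, false]

/-- A decrement of the position counter. -/
def tick (C : Checker k α) : Fin k → SignType :=
  match C.position with
  | some i => Pi.single i (-1)
  | none => 0

theorem tick_ne_one (C : Checker k α) (i : Fin k) : C.tick i ≠ 1 := by
  unfold tick
  cases C.position with
  | none => simp
  | some j => by_cases h : i = j <;> simp [h]

theorem tick_eq_zero (C : Checker k α) {i : Fin k} (hi : C.position ≠ some i) :
    C.tick i = 0 := by
  unfold tick
  cases hp : C.position with
  | none => simp
  | some j =>
    have : i ≠ j := fun h => hi (by rw [hp, h])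
    simp [this]

/-- Accept all words without a further mark. -/
def succeed : Option (Marked α) → List (State × Bool × (Fin k → SignType))
  | some (some _) => [(acc, true, 0)]
  | some none => [(final, true, 0)]
  | none => []

variable [DecidableEq α]

/-- The transition rule of a checker for histories with the first two members `0` and `N`. -/
noncomputable def rule (C : Checker k α) (N : ℕ) :
    State → Option (Marked α) → (Fin k → Bool) → List (State × Bool × (Fin k → SignType))
  | start, some (some x), _ =>
    if x = C.unit then C.position.toList.map fun i => (start, true, Pi.single i 1) else []
  | start, some none, p =>
    (C.test p).map fun b => if b then (skip, true, C.tick) else (first, true, 0)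
  | skip, some _, p =>
    (C.test p).map fun b => if b then (mid, false, C.tick) else (count 0, false, 0)
  | mid, some (some x), _ => if x = C.unit then [(mid, true, 0)] else [(skip, true, 0)]
  | count i, some (some x), _ =>
    if x = C.unit then
      if i + 1 = C.recur.m then [(count 0, true, Pi.single C.compare 1)] else [(count (i + 1), true, 0)]
    else [(resid i 0, true, 0)]
  | resid i j, some (some x), _ =>
    if x = C.unit then [(resid i ((j + 1) % C.recur.m), true, 0)]
    else [(remain i j (C.recur.const i j), true, 0)]
  | resid i j, some none, _ =>
    open Classical in if C.recur.halt i j then [] else [(final, true, 0)]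
  | remain i j (e + 1), r, _ =>
    if r = some (some C.unit) then [(remain i j e, true, 0)] else succeed r
  | remain i j 0, r, p =>
    if p C.compare then [(remain i j (C.recur.coeff i j), false, Pi.single C.compare (-1))]
    else if r = some (some C.unit) then succeed r else []
  | first, some (some x), _ => if x = C.unit then [(acc, true, 0)] else [(pre N, true, 0)]
  | first, some none, _ => [(final, true, 0)]
  | pre j, r, _ =>
    if r = some (some C.unit) then if j = 0 then succeed r else [(pre (j - 1), true, 0)]
    else if j = 0 then [] else succeed r
  | acc, r, _ => succeed r
  | _, _, _ => []

/-- The states other than those that compare the second member. -/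
def mainStates (C : Checker k α) : List State :=
  start :: skip :: mid :: first :: acc :: (List.range C.recur.m).flatMap fun i =>
    count i :: (List.range C.recur.m).flatMap fun j =>
      resid i j :: (List.range (C.recur.coeff i j + C.recur.const i j + 1)).map (remain i j)

/-- The states of a checker for histories with the first two members `0` and `N`. -/
def states (C : Checker k α) (N : ℕ) : List State :=
  C.mainStates ++ (List.range (N + 1)).map pre

/-- A checker for histories with the first two members `0` and `N`, as a machine. -/
noncomputable def machine [Fintype α] (C : Checker k α) (N : ℕ) : CounterMachine k (Marked α) :=
  machineOf State.code (C.rule N) start final (C.states N)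

/-- Decrements follow a positive test of the same counter. A guessed test is harmless, because
`tick` is then zero. -/
theorem rule_wellFormed (C : Checker k α) (N : ℕ) (s : State) (r : Option (Marked α))
    (p : Fin k → Bool) (o : State × Bool × (Fin k → SignType)) (ho : o ∈ C.rule N s r p)
    (i : Fin k) (hi : p i = false) : 0 ≤ o.2.2 i := by
  have hs : ∀ j, 0 ≤ (Pi.single j 1 : Fin k → SignType) i := fun j => by
    by_cases h : i = j
    · subst h; simp
    · simp [h]
  have hn : ∀ j, p j = true → 0 ≤ (Pi.single j (-1) : Fin k → SignType) i := fun j hj => by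
    by_cases h : i = j
    · subst h; simp [hi] at hj
    · simp [h]
  have ht : true ∈ C.test p → 0 ≤ C.tick i := by
    unfold test tick
    cases C.position with
    | none => simp
    | some j => simpa using fun h => hn j h
  unfold rule at ho
  split at ho <;> try unfold succeed at ho
  all_goals try split_ifs at ho
  all_goals try split at ho
  all_goals
    simp only [List.mem_map, List.mem_singleton, List.not_mem_nil] at ho
  all_goals try
    subst ho
    first
    | exact le_rfl
    | exact hs _
    | exact hn _ ‹_›
  all_goals try
    obtain ⟨b, hb, rfl⟩ := ho
    first
    | exact hs _
    | cases b
      · exact le_rfl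
      · exact ht hb

/-- The guessed outcome of `test` is the only source of nondeterminism. -/
theorem rule_length_le_one (C : Checker k α) (hC : C.position.isSome) (N : ℕ) (s : State)
    (r : Option (Marked α)) (p : Fin k → Bool) : (C.rule N s r p).length ≤ 1 := by
  obtain ⟨i, hi⟩ := Option.isSome_iff_exists.1 hC
  unfold rule
  simp only [test, hi]
  split <;> try unfold succeed
  all_goals try split_ifs
  all_goals try split
  all_goals simp

/-- The phase of a state with respect to the position counter. -/
def posPhase : State → ℕ
  | start => 0
  | _ => 1

/-- The phase of a state with respect to the counter of the comparison. -/
def cmpPhase : State → ℕ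
  | start | skip | mid | first | pre _ | count _ | resid _ _ => 0
  | _ => 1

/-- The phase of a state with respect to a counter with both roles. -/
def bothPhase : State → ℕ
  | start => 0
  | skip | mid | first | pre _ => 1
  | count _ | resid _ _ => 2
  | _ => 3


theorem single_one_ne_neg_one (i j : Fin k) : (Pi.single j 1 : Fin k → SignType) i ≠ -1 := by
  by_cases h : i = j
  · subst h; simp
  · simp [h]

theorem single_neg_one_ne_one (i j : Fin k) : (Pi.single j (-1) : Fin k → SignType) i ≠ 1 := by
  by_cases h : i = j
  · subst h; simp
  · simp [h]

/-- With separate roles each counter first only grows and then only shrinks: the position counter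
grows before the first mark, the comparison counter while the block under test is counted. -/
theorem isNCM_machine [Fintype α] (C : Checker k α) (hC : C.position ≠ some C.compare) (N : ℕ) :
    (C.machine N).IsNCM 1 := by
  refine ⟨wellFormed_machineOf (C.rule_wellFormed N), ?_⟩
  refine reversalBounded_machineOf State.code_injective
    (fun i => if i = C.compare then cmpPhase else posPhase) fun i s r p o ho => ?_
  have h1 := single_one_ne_neg_one i
  have h2 := C.tick_ne_one i
  have h3 : i = C.compare → C.tick i = 0 := fun h => C.tick_eq_zero (h ▸ hC)
  have h4 : i ≠ C.compare → (Pi.single C.compare 1 : Fin k → SignType) i = 0 := fun h => by simp [h]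
  have h5 := single_neg_one_ne_one i
  unfold rule at ho
  split at ho <;> try unfold succeed at ho
  all_goals try split_ifs at ho
  all_goals try split at ho
  all_goals
    simp only [List.mem_map, List.mem_singleton, List.not_mem_nil] at ho
  all_goals try
    subst ho
    by_cases hi : i = C.compare
  all_goals try
    obtain ⟨b, hb, rfl⟩ := ho
    by_cases hi : i = C.compare <;> cases b
  all_goals simp_all [cmpPhase, posPhase]

/-- A counter with both roles goes up, down, up, down: the block number is used up before the block
is counted. -/
theorem isNCM_machine_three [Fintype α] (C : Checker k α) (hk : ∀ i : Fin k, i = C.compare)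
    (N : ℕ) : (C.machine N).IsNCM 3 := by
  refine ⟨wellFormed_machineOf (C.rule_wellFormed N), ?_⟩
  refine reversalBounded_machineOf State.code_injective
    (fun _ => bothPhase) fun i s r p o ho => ?_
  have h1 := single_one_ne_neg_one i
  have h2 := C.tick_ne_one i
  have h5 := single_neg_one_ne_one i
  unfold rule at ho
  split at ho <;> try unfold succeed at ho
  all_goals try split_ifs at ho
  all_goals try split at ho
  all_goals
    simp only [List.mem_map, List.mem_singleton, List.not_mem_nil] at ho
  all_goals try
    subst ho
  all_goals try
    obtain ⟨b, hb, rfl⟩ := ho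
    cases b
  all_goals simp_all [bothPhase, show Odd 3 by decide]

theorem isDCM_machine_one [Fintype α] (C : Checker k α) (hC : C.position ≠ some C.compare)
    (hC' : C.position.isSome) (N : ℕ) : (C.machine N).IsDCM 1 :=
  ⟨C.isNCM_machine hC N, deterministic_machineOf State.code_injective (C.rule_length_le_one hC' N)⟩

theorem isDCM_machine_three [Fintype α] (C : Checker k α) (hk : ∀ i : Fin k, i = C.compare)
    (hC' : C.position.isSome) (N : ℕ) : (C.machine N).IsDCM 3 :=
  ⟨C.isNCM_machine_three hk N,
    deterministic_machineOf State.code_injective (C.rule_length_le_one hC' N)⟩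

end Checker

/-! ### What the checker accepts from each state -/

namespace Checker

open State

variable {k : ℕ} {α : Type*} [DecidableEq α] [Fintype α]

/-- The checker accepts from the given state, rest of the tape and counters. -/
def Acc (C : Checker k α) (N : ℕ) (s : State) (tape : List (Option (Marked α))) (c : Fin k → ℕ) :
    Prop :=
  (C.machine N).Accepts ⟨s.code, tape, c⟩

/-- The tape that holds the word `w`, a mark, and the end-marker. -/
def tapeOf (w : List α) : List (Option (Marked α)) :=
  w.map (fun x => some (some x)) ++ [some none, none]

omit [DecidableEq α] [Fintype α] in
@[simp] theorem tapeOf_nil : tapeOf ([] : List α) = [some none, none] := rfl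

omit [DecidableEq α] [Fintype α] in
@[simp] theorem tapeOf_cons (x : α) (w : List α) :
    tapeOf (x :: w) = some (some x) :: tapeOf w := rfl

variable {C : Checker k α} {N : ℕ}

theorem acc_iff {s : State} (hs : s ∈ C.states N) (r : Option (Marked α))
    (tape : List (Option (Marked α))) (c : Fin k → ℕ) :
    C.Acc N s (r :: tape) c ↔ (s = final ∧ r :: tape = [none]) ∨
      ∃ o ∈ C.rule N s r (fun i => decide (0 < c i)),
        C.Acc N o.1 (if o.2.1 = true then tape else r :: tape) (updCounters c o.2.2) :=
  accepts_machineOf_iff State.code_injective (C.rule_wellFormed N) hs r tape c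

theorem acc_final (c : Fin k → ℕ) : C.Acc N final [none] c :=
  ⟨[], _, .nil _, by simp [machine, machineOf], rfl⟩

theorem acc_acc (w : List α) (c : Fin k → ℕ) : C.Acc N acc (tapeOf w) c := by
  have hs : acc ∈ C.states N := by simp [states, mainStates]
  induction w with
  | nil => simp [acc_iff hs, rule, succeed, acc_final]
  | cons x w ih => simp [acc_iff hs, rule, succeed, ih]

/-- The state still expects `e` letters before it looks at the counter; each unit of the counter
then buys `coeff i j` further ones. So the expected length is `coeff i j * n + e`, and any deviation
is accepted. The bound on `e` only keeps the state in the finite list. -/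
theorem acc_remain {i j : ℕ} (hi : i < C.recur.m) (hj : j < C.recur.m) (n : ℕ) :
    ∀ (e : ℕ) (w : List α) (c : Fin k → ℕ), e ≤ C.recur.coeff i j + C.recur.const i j →
      c C.compare = n →
      (C.Acc N (remain i j e) (tapeOf w) c ↔ lead C.unit w ≠ C.recur.coeff i j * n + e) := by
  have hs : ∀ e ≤ C.recur.coeff i j + C.recur.const i j, remain i j e ∈ C.states N := by
    intro e he
    simpa [states, mainStates] using ⟨hi, hj, by omega⟩
  induction n with
  | zero =>
    intro e
    induction e with
    | zero =>
      intro w c he hc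
      cases w with
      | nil => simp [acc_iff (hs 0 he), rule, hc, lead]
      | cons x w => by_cases hx : x = C.unit <;>
          simp [acc_iff (hs 0 he), rule, hc, lead, hx, succeed, acc_acc]
    | succ e ih =>
      intro w c he hc
      cases w with
      | nil => simp [acc_iff (hs _ he), rule, lead, succeed, acc_final]
      | cons x w => by_cases hx : x = C.unit <;>
          simp [acc_iff (hs _ he), rule, hc, lead, hx, succeed, acc_acc, ih w c (by omega)]
  | succ n ihn =>
    intro e
    induction e with
    | zero =>
      intro w c he hc
      have := ihn (C.recur.coeff i j) w (Function.update c C.compare (c C.compare - 1)) (by omega)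
        (by simp [hc])
      have h' : C.Acc N (remain i j 0) (tapeOf w) c ↔ C.Acc N (remain i j (C.recur.coeff i j))
          (tapeOf w) (Function.update c C.compare (c C.compare - 1)) := by
        cases w <;> simp [acc_iff (hs 0 he), rule, hc]
      rw [h', this, Nat.mul_succ, Nat.add_zero]
    | succ e ih =>
      intro w c he hc
      cases w with
      | nil => simp [acc_iff (hs _ he), rule, lead, succeed, acc_final]
      | cons x w => by_cases hx : x = C.unit
                    · simp [acc_iff (hs _ he), rule, hc, lead, hx, ih w c (by omega), ← add_assoc]
                    · simp [acc_iff (hs _ he), rule, lead, hx, succeed, acc_acc]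

/-- If the word ends with this block, the halting condition decides; a separator starts the
comparison with `const i j` letters due. -/
theorem acc_resid {i : ℕ} (hi : i < C.recur.m) (w : List α) (c : Fin k → ℕ) :
    ∀ j < C.recur.m, (C.Acc N (resid i j) (tapeOf w) c ↔
      C.recur.Wrong i ((j + lead C.unit w) % C.recur.m) (c C.compare) (more C.unit w)) := by
  have hs : ∀ j < C.recur.m, resid i j ∈ C.states N := by
    intro j hj
    simpa [states, mainStates] using ⟨hi, hj⟩
  induction w with
  | nil =>
    intro j hj
    by_cases h : C.recur.halt i j <;>
      simp [acc_iff (hs j hj), rule, lead, more, Recurrence.Wrong, Nat.mod_eq_of_lt hj, h, acc_final]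
  | cons x w ih =>
    intro j hj
    by_cases hx : x = C.unit
    · simp [acc_iff (hs j hj), rule, lead, more, hx, ih _ (Nat.mod_lt _ C.recur.m_pos),
        add_right_comm, add_assoc]
    · simp [acc_iff (hs j hj), rule, lead, more, hx, Recurrence.Wrong, Nat.mod_eq_of_lt hj,
        acc_remain hi hj]

/-- Invariant: `m * c + i` letters of the block have been read, with `c` the comparison counter. A
word ending within this block is rejected, in accordance with `Err` being false on a singleton. -/
theorem acc_count (w : List α) :
    ∀ i < C.recur.m, ∀ c : Fin k → ℕ, (C.Acc N (count i) (tapeOf w) c ↔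
      C.recur.Err ((C.recur.m * c C.compare + i + lead C.unit w) :: more C.unit w)) := by
  have hs : ∀ i < C.recur.m, count i ∈ C.states N := by
    intro i hi
    simpa [states, mainStates] using hi
  induction w with
  | nil =>
    intro i hi c
    simp [acc_iff (hs i hi), rule, more, Recurrence.Err]
  | cons x w ih =>
    intro i hi c
    by_cases hx : x = C.unit
    · by_cases hm : i + 1 = C.recur.m
      · have : C.recur.m * (c C.compare + 1) + 0 + lead C.unit w =
            C.recur.m * c C.compare + i + (lead C.unit w + 1) := by rw [Nat.mul_succ]; omega
        simp [acc_iff (hs i hi), rule, lead, more, hx, hm, ih 0 C.recur.m_pos, ← this]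
      · have : C.recur.m * c C.compare + (i + 1) + lead C.unit w =
            C.recur.m * c C.compare + i + (lead C.unit w + 1) := by omega
        simp [acc_iff (hs i hi), rule, lead, more, hx, hm, ih (i + 1) (by omega), ← this]
    · have h1 : (C.recur.m * c C.compare + i) % C.recur.m = i := by
        rw [Nat.mul_add_mod, Nat.mod_eq_of_lt hi]
      have h2 : (C.recur.m * c C.compare + i) / C.recur.m = c C.compare := by
        rw [Nat.mul_add_div C.recur.m_pos, Nat.div_eq_of_lt hi, Nat.add_zero]
      simp [acc_iff (hs i hi), rule, lead, more, hx, acc_resid hi _ _ 0 C.recur.m_pos,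
        Recurrence.Err, h1, h2]

theorem acc_count_zero (w : List α) (c : Fin k → ℕ) (hc : c C.compare = 0) :
    C.Acc N (count 0) (tapeOf w) c ↔ C.recur.Err (blocks C.unit w) := by
  simp [acc_count w 0 C.recur.m_pos, hc, blocks]

/-- The number `N` is counted down in the finite control, without a counter. -/
theorem acc_pre (w : List α) (c : Fin k → ℕ) :
    ∀ j ≤ N, (C.Acc N (pre j) (tapeOf w) c ↔ lead C.unit w ≠ j) := by
  have hs : ∀ j ≤ N, pre j ∈ C.states N := by
    intro j hj
    exact List.mem_append_right _ (List.mem_map_of_mem (List.mem_range.2 (by omega)))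
  induction w with
  | nil =>
    intro j hj
    cases j <;> simp [acc_iff (hs _ hj), rule, lead, succeed, acc_final]
  | cons x w ih =>
    intro j hj
    by_cases hx : x = C.unit
    · cases j with
      | zero => simp [acc_iff (hs _ hj), rule, lead, hx, succeed, acc_acc]
      | succ j => simp [acc_iff (hs _ hj), rule, lead, hx, ih j (by omega)]
    · cases j <;> simp [acc_iff (hs _ hj), rule, lead, hx, succeed, acc_acc]

theorem acc_first (w : List α) (c : Fin k → ℕ) :
    C.Acc N first (tapeOf w) c ↔ ¬ ∃ l, blocks C.unit w = 0 :: N :: l := by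
  have hs : first ∈ C.states N := by simp [states, mainStates]
  cases w with
  | nil => simp [acc_iff hs, rule, blocks, more, acc_final]
  | cons x w =>
    by_cases hx : x = C.unit
    · simp [acc_iff hs, rule, hx, blocks, lead, acc_acc]
    · simp [acc_iff hs, rule, hx, blocks, lead, more, acc_pre w c N le_rfl]

/-- One unit of the position counter is spent per skipped block. The comparison starts from zero in
either case: a separate counter is untouched, and a shared one has just been exhausted. -/
theorem acc_skip_of_position {p : Fin k} (hp : C.position = some p) (w : List α) :
    (∀ c : Fin k → ℕ, (C.compare ≠ p → c C.compare = 0) →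
      (C.Acc N mid (tapeOf w) c ↔ C.recur.Err ((more C.unit w).drop (c p)))) ∧
    ∀ c : Fin k → ℕ, (C.compare ≠ p → c C.compare = 0) →
      (C.Acc N skip (tapeOf w) c ↔ C.recur.Err ((blocks C.unit w).drop (c p))) := by
  have hs : skip ∈ C.states N := by simp [states, mainStates]
  have hs' : mid ∈ C.states N := by simp [states, mainStates]
  -- `skip` leaves the head in place, so its claim follows from that for `mid` on the same word.
  have key : ∀ w : List α, (∀ c : Fin k → ℕ, (C.compare ≠ p → c C.compare = 0) →
      (C.Acc N mid (tapeOf w) c ↔ C.recur.Err ((more C.unit w).drop (c p)))) →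
      ∀ c : Fin k → ℕ, (C.compare ≠ p → c C.compare = 0) →
      (C.Acc N skip (tapeOf w) c ↔ C.recur.Err ((blocks C.unit w).drop (c p))) := by
    intro w h c hc
    have h' : C.Acc N skip (tapeOf w) c ↔ if 0 < c p
        then C.Acc N mid (tapeOf w) (Function.update c p (c p - 1))
        else C.Acc N (count 0) (tapeOf w) c := by
      cases w <;> by_cases h0 : 0 < c p <;> simp [acc_iff hs, rule, test, tick, hp, h0]
    rw [h']
    split_ifs with h0
    · rw [h _ (fun hne => by simp [hne, hc hne])]
      obtain ⟨n, hn⟩ := Nat.exists_eq_succ_of_ne_zero h0.ne'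
      simp [hn, blocks]
    · have h0 : c p = 0 := by omega
      rw [acc_count_zero w c (by by_cases hq : C.compare = p; · rw [hq, h0]
                                 · exact hc hq), h0, List.drop_zero]
  induction w with
  | nil =>
    have : ∀ c : Fin k → ℕ, (C.compare ≠ p → c C.compare = 0) →
      (C.Acc N mid (tapeOf []) c ↔ C.recur.Err ((more C.unit ([] : List α)).drop (c p))) := by
      intro c _
      simp [acc_iff hs', rule, more, Recurrence.Err]
    exact ⟨this, key [] this⟩
  | cons x w ih =>
    have : ∀ c : Fin k → ℕ, (C.compare ≠ p → c C.compare = 0) →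
      (C.Acc N mid (tapeOf (x :: w)) c ↔ C.recur.Err ((more C.unit (x :: w)).drop (c p))) := by
      intro c hc
      by_cases hx : x = C.unit
      · simp [acc_iff hs', rule, more, hx, ih.1 c hc]
      · simp [acc_iff hs', rule, more, hx, ih.2 c hc, blocks]
    exact ⟨this, key _ this⟩

/-- Both outcomes of the test are available at every block, so the number of skipped blocks is
arbitrary. -/
theorem acc_skip_of_guess (hp : C.position = none) (w : List α) (c : Fin k → ℕ)
    (hc : c C.compare = 0) :
    (C.Acc N mid (tapeOf w) c ↔ ∃ n, C.recur.Err ((more C.unit w).drop n)) ∧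
    (C.Acc N skip (tapeOf w) c ↔ ∃ n, C.recur.Err ((blocks C.unit w).drop n)) := by
  have hs : skip ∈ C.states N := by simp [states, mainStates]
  have hs' : mid ∈ C.states N := by simp [states, mainStates]
  have key : ∀ w : List α,
      (C.Acc N mid (tapeOf w) c ↔ ∃ n, C.recur.Err ((more C.unit w).drop n)) →
      (C.Acc N skip (tapeOf w) c ↔ ∃ n, C.recur.Err ((blocks C.unit w).drop n)) := by
    intro w h
    have h' : C.Acc N skip (tapeOf w) c ↔
        C.Acc N mid (tapeOf w) c ∨ C.Acc N (count 0) (tapeOf w) c := by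
      cases w <;> simp [acc_iff hs, rule, test, tick, hp]
    rw [h', h, acc_count_zero w c hc]
    constructor
    · rintro (⟨n, hn⟩ | h0)
      · exact ⟨n + 1, by simpa [blocks] using hn⟩
      · exact ⟨0, by simpa using h0⟩
    · rintro ⟨_ | n, hn⟩
      · exact Or.inr (by simpa using hn)
      · exact Or.inl ⟨n, by simpa [blocks] using hn⟩
  induction w with
  | nil =>
    have : C.Acc N mid (tapeOf []) c ↔
        ∃ n, C.recur.Err ((more C.unit ([] : List α)).drop n) := by
      simp [acc_iff hs', rule, more, Recurrence.Err]
    exact ⟨this, key [] this⟩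
  | cons x w ih =>
    have : C.Acc N mid (tapeOf (x :: w)) c ↔
        ∃ n, C.recur.Err ((more C.unit (x :: w)).drop n) := by
      by_cases hx : x = C.unit
      · simp [acc_iff hs', rule, more, hx, ih.1]
      · simp [acc_iff hs', rule, more, hx, ih.2, blocks]
    exact ⟨this, key _ this⟩

end Checker

/-! ### Density of languages of words `a^n $ w $` -/

section MarkedShape

variable {α : Type*}

theorem append_mark_inj {x x' r r' : List (Marked α)} (hx : none ∉ x) (hx' : none ∉ x')
    (h : x ++ none :: r = x' ++ none :: r') : x = x' ∧ r = r' := by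
  induction x generalizing x' with
  | nil =>
    cases x' with
    | nil => simpa using h
    | cons y x' => simp at h hx'; exact absurd h.1 hx'.1
  | cons z x ih =>
    cases x' with
    | nil => simp at h hx; exact absurd h.1.symm hx.1
    | cons y x' =>
      simp only [List.cons_append, List.cons.injEq, List.mem_cons, not_or] at h hx hx'
      obtain ⟨h1, h2⟩ := ih hx.2 hx'.2 h.2
      exact ⟨by rw [h.1, h1], h2⟩

/-- Both sides contain two marks within the displayed words, so `x` and `y` contain none, and the
marks determine what lies between them. -/
theorem eq_of_marked_infix {a : α} {n : ℕ} {w w' : List α} {x y : List (Marked α)}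
    (h : x ++ ([none] ++ w.map some ++ [none]) ++ y =
      List.replicate n (some a) ++ ([none] ++ w'.map some ++ [none])) : w = w' := by
  classical
  have hc := congrArg (List.count none) h
  have hn : ∀ w : List α, List.count none (w.map some) = 0 := fun w =>
    List.count_eq_zero_of_not_mem (by simp)
  simp only [List.count_append, hn, List.count_replicate] at hc
  simp at hc
  have hx : none ∉ x := List.count_eq_zero.1 (by omega)
  have hy : none ∉ y := List.count_eq_zero.1 (by omega)
  simp only [List.append_assoc, List.cons_append, List.nil_append] at h
  obtain ⟨-, h⟩ := append_mark_inj hx (by simp [List.mem_replicate]) h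
  obtain ⟨h, -⟩ := append_mark_inj (by simp) (by simp) h
  exact List.map_injective_iff.2 (Option.some_injective α) h

variable {L : Language (Marked α)} {a : α} {G : ℕ → List α → Prop}
  (hL : ∀ u, u ∈ L ↔ ∃ n w, u = List.replicate n (some a) ++ ([none] ++ w.map some ++ [none]) ∧
    G n w)
include hL

theorem markedDense_suff_iff : MarkedDense suff L ↔ ∀ w, ∃ n, G n w := by
  constructor
  · intro h w
    obtain ⟨x, hx⟩ := h ⟨w, rfl⟩
    obtain ⟨n, w', e, hg⟩ := (hL _).1 hx
    have := eq_of_marked_infix (y := []) ((List.append_nil _).trans e)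
    exact ⟨n, this ▸ hg⟩
  · rintro h _ ⟨w, rfl⟩
    obtain ⟨n, hn⟩ := h w
    exact ⟨_, (hL _).2 ⟨n, w, rfl, hn⟩⟩

theorem markedDense_infx_iff : MarkedDense infx L ↔ ∀ w, ∃ n, G n w := by
  constructor
  · intro h w
    obtain ⟨x, y, hx⟩ := h ⟨w, rfl⟩
    obtain ⟨n, w', e, hg⟩ := (hL _).1 hx
    exact ⟨n, eq_of_marked_infix e ▸ hg⟩
  · rintro h _ ⟨w, rfl⟩
    obtain ⟨n, hn⟩ := h w
    exact ⟨_, [], (hL _).2 ⟨n, w, by rw [List.append_nil], hn⟩⟩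

/-- A word of `L` that extends `$w$` to the right has no letters before its first mark; `hG` is what
lets every witness be of this kind. -/
theorem markedDense_pref_iff (hG : ∀ n w, G n w → n = 0) :
    MarkedDense pref L ↔ ∀ w, ∃ n, G n w := by
  constructor
  · intro h w
    obtain ⟨y, hx⟩ := h ⟨w, rfl⟩
    obtain ⟨n, w', e, hg⟩ := (hL _).1 hx
    exact ⟨n, eq_of_marked_infix (x := []) e ▸ hg⟩
  · rintro h _ ⟨w, rfl⟩
    obtain ⟨n, hn⟩ := h w
    obtain rfl := hG n w hn
    exact ⟨[], (hL _).2 ⟨0, w, by simp, hn⟩⟩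

end MarkedShape

/-! ### The language of a checker -/

namespace Checker

open State

variable {k : ℕ} {α : Type*} [DecidableEq α] [Fintype α] {C : Checker k α} {N : ℕ}

theorem exists_rule_of_step {x y : Config k (Marked α)} {t : Transition k (Marked α)}
    (h : (C.machine N).Step x t y) {s : State} (hs : x.state = s.code) :
    ∃ o ∈ C.rule N s t.read t.positive, y.state = o.1.code ∧
      y.tape = if o.2.1 = true then x.tape.tail else x.tape := by
  obtain ⟨ht, h1, h2, h3, h4, h5, h6⟩ := h
  obtain ⟨s', -, o, ho, e⟩ := mem_trans_machineOf.1 ht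
  have hs' : s' = s := State.code_injective (by rw [← hs, h1, e])
  subst hs'
  refine ⟨o, ho, by rw [h4, e], ?_⟩
  rw [e] at h5
  exact h5

omit [Fintype α] in
-- After `start`, a mark is consumed only on entering `final`, and the end-marker never.
theorem rule_shape (s : State) (hs : s ≠ start) (r : Option (Marked α)) (p : Fin k → Bool)
    (o : State × Bool × (Fin k → SignType)) (ho : o ∈ C.rule N s r p) :
    o.1 ≠ start ∧ (o.1 = final ∧ r = some none ∧ o.2.1 = true ∨
      o.1 ≠ final ∧ (o.2.1 = true → ∃ x, r = some (some x))) := by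
  unfold rule at ho
  split at ho <;> try unfold succeed at ho
  all_goals try split_ifs at ho
  all_goals try split at ho
  all_goals
    simp only [List.mem_map, List.mem_singleton, List.not_mem_nil] at ho
  all_goals try
    subst ho
  all_goals try
    obtain ⟨b, hb, rfl⟩ := ho
    cases b
  all_goals simp_all

/-- Since `final` is a dead end, the mark that leads to it must be the last input symbol. This
excludes accepted inputs of any other shape, about which the lemmas on `tapeOf` say nothing. -/
theorem exists_word_of_run {x y : Config k (Marked α)} {ts : List (Transition k (Marked α))}
    (hr : (C.machine N).Run x ts y) (hy : y.state ∈ (C.machine N).accept) (hy' : y.tape = [none]) :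
    ∀ s : State, x.state = s.code → s ≠ start → (s = final → x.tape = [none]) ∧
      ∀ u : List (Marked α), s ≠ final → x.tape = u.map some ++ [none] →
        ∃ w : List α, u = w.map some ++ [none] := by
  induction hr with
  | nil x =>
    intro s hs _
    refine ⟨fun _ => hy', fun u hf _ => absurd ?_ hf⟩
    refine State.code_injective ?_
    rw [← hs]
    simpa [machine, machineOf] using hy
  | cons hst _ ih =>
    intro s hs hs'
    have ht := hst.2.2.1
    obtain ⟨o, ho, h1, h2⟩ := exists_rule_of_step hst hs
    obtain ⟨h3, h4⟩ := rule_shape s hs' _ _ o ho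
    obtain ⟨ih1, ih2⟩ := ih hy hy' o.1 h1 h3
    refine ⟨fun hf => ?_, fun u _ hu => ?_⟩
    · subst hf
      simp [rule] at ho
    · rw [hu] at h2 ht
      rcases h4 with ⟨h5, h6, h7⟩ | ⟨h5, h6⟩
      · have := ih1 h5
        cases u with
        | nil => simp [h6] at ht
        | cons z u =>
          simp only [h2, h7, if_true, List.map_cons, List.cons_append, List.tail_cons] at this
          have hu : u = [] := by
            cases u with
            | nil => rfl
            | cons z' u => simp at this
          have hz : z = none := by simpa [h6] using ht
          exact ⟨[], by simp [hu, hz]⟩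
      · by_cases hm : o.2.1 = true
        · obtain ⟨a, ha⟩ := h6 hm
          cases u with
          | nil => simp [ha] at ht
          | cons z u =>
            obtain ⟨w, hw⟩ := ih2 u h5 (by simp [h2, hm])
            exact ⟨a :: w, by
              have hz : z = some a := by simpa [ha] using ht
              simp [hz, hw]⟩
        · exact ih2 u h5 (by simp [h2, hm])

theorem exists_word_of_acc {s : State} {u : List (Marked α)} {c : Fin k → ℕ}
    (h : C.Acc N s (u.map some ++ [none]) c) (hs : s ≠ start) (hs' : s ≠ final) :
    ∃ w : List α, u = w.map some ++ [none] := by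
  obtain ⟨ts, y, hr, hy, hy'⟩ := h
  exact (exists_word_of_run hr hy hy' s rfl hs).2 u hs' rfl

omit [DecidableEq α] [Fintype α] in
theorem map_some_word (w : List α) :
    ((w.map some ++ [none] : List (Marked α)).map some ++ [none]) = tapeOf w := by
  simp [tapeOf]

/-- What a checker verifies: the word does not begin correctly, or it is wrong at a given block. -/
def Detects (C : Checker k α) (N : ℕ) : ℕ → List α → Prop
  | 0, w => ¬ ∃ l, blocks C.unit w = 0 :: N :: l
  | n + 1, w => C.recur.Err ((blocks C.unit w).drop n)

omit [DecidableEq α] [Fintype α] in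
theorem start_mem_states : start ∈ C.states N := by simp [states, mainStates]

theorem exists_word_of_acc_start {u : List (Marked α)} {c : Fin k → ℕ}
    (h : C.Acc N start ((none :: u).map some ++ [none]) c) :
    ∃ w : List α, u = w.map some ++ [none] := by
  rcases (acc_iff start_mem_states _ _ c).1 h with h' | ⟨o, ho, h'⟩
  · simp at h'
  · obtain ⟨b, -, rfl⟩ := List.mem_map.1 ho
    cases b
    · exact exists_word_of_acc (s := first) h' (by simp) (by simp)
    · exact exists_word_of_acc (s := skip) h' (by simp) (by simp)

/-- A zero counter selects the test of the beginning; otherwise one unit is spent on the mark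
itself, whence the shift by one in `Detects`. -/
theorem acc_start_mark_of_position {p : Fin k} (hp : C.position = some p) (w : List α)
    (c : Fin k → ℕ) (hc : C.compare ≠ p → c C.compare = 0) :
    C.Acc N start (some none :: tapeOf w) c ↔ C.Detects N (c p) w := by
  have h : C.Acc N start (some none :: tapeOf w) c ↔ if 0 < c p
      then C.Acc N skip (tapeOf w) (Function.update c p (c p - 1))
      else C.Acc N first (tapeOf w) c := by
    by_cases h0 : 0 < c p <;> simp [acc_iff start_mem_states, rule, test, tick, hp, h0]
  rw [h]
  split_ifs with h0
  · rw [(acc_skip_of_position hp w).2 _ (fun hne => by simp [hne, hc hne])]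
    obtain ⟨n, hn⟩ := Nat.exists_eq_succ_of_ne_zero h0.ne'
    simp [hn, Detects]
  · have h0 : c p = 0 := by omega
    rw [acc_first, h0, Detects]

theorem acc_start_of_position {p : Fin k} (hp : C.position = some p) (u : List (Marked α)) :
    ∀ c : Fin k → ℕ, (C.compare ≠ p → c C.compare = 0) →
    (C.Acc N start (u.map some ++ [none]) c ↔ ∃ n w,
      u = List.replicate n (some C.unit) ++ ([none] ++ w.map some ++ [none]) ∧
        C.Detects N (c p + n) w) := by
  induction u with
  | nil =>
    intro c _
    simp [acc_iff start_mem_states, rule]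
  | cons x u ih =>
    intro c hc
    cases x with
    | none =>
      constructor
      · intro h
        obtain ⟨w, rfl⟩ := exists_word_of_acc_start h
        refine ⟨0, w, by simp, ?_⟩
        rw [List.map_cons, List.cons_append, map_some_word,
          acc_start_mark_of_position hp w c hc] at h
        simpa using h
      · rintro ⟨n, w, e, h⟩
        cases n with
        | succ n => simp [List.replicate_succ] at e
        | zero =>
          simp at e
          rw [e, List.map_cons, List.cons_append, map_some_word,
            acc_start_mark_of_position hp w c hc]
          simpa using h
    | some x =>
      by_cases hx : x = C.unit
      · have : C.Acc N start ((some x :: u).map some ++ [none]) c ↔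
            C.Acc N start (u.map some ++ [none]) (Function.update c p (c p + 1)) := by
          simp [acc_iff start_mem_states, rule, hp, hx]
        rw [this, ih _ fun hne => by simp [hne, hc hne]]
        constructor
        · rintro ⟨n, w, rfl, h⟩
          refine ⟨n + 1, w, by simp [List.replicate_succ, hx], ?_⟩
          rw [Function.update_self] at h
          rwa [← add_assoc, add_right_comm]
        · rintro ⟨_ | n, w, e, h⟩
          · simp at e
          · refine ⟨n, w, by simpa [List.replicate_succ, hx] using e, ?_⟩
            rw [Function.update_self]
            rwa [← add_assoc, add_right_comm] at h
      · simp [acc_iff start_mem_states, rule, hx]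
        rintro (_ | n) w h
        · simp at h
        · simp [List.replicate_succ, hx] at h

theorem mem_language_of_position {p : Fin k} (hp : C.position = some p) (u : List (Marked α)) :
    u ∈ (C.machine N).language ↔ ∃ n w,
      u = List.replicate n (some C.unit) ++ ([none] ++ w.map some ++ [none]) ∧
        C.Detects N n w := by
  have := acc_start_of_position (N := N) hp u (fun _ => 0) fun _ => rfl
  simp only [Nat.zero_add] at this
  exact this

/-- Without a position counter `start` has no transition on letters, which forces `n = 0`. -/
theorem mem_language_of_guess (hp : C.position = none) (u : List (Marked α)) :
    u ∈ (C.machine N).language ↔ ∃ n w,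
      u = List.replicate n (some C.unit) ++ ([none] ++ w.map some ++ [none]) ∧
        (n = 0 ∧ ∃ m, C.Detects N m w) := by
  change C.Acc N start (u.map some ++ [none]) (fun _ => 0) ↔ _
  have key : ∀ w : List α, C.Acc N start (some none :: tapeOf w) (fun _ => 0) ↔
      ∃ m, C.Detects N m w := by
    intro w
    have h : C.Acc N start (some none :: tapeOf w) (fun _ => 0) ↔
        C.Acc N skip (tapeOf w) (fun _ => 0) ∨ C.Acc N first (tapeOf w) (fun _ => 0) := by
      simp [acc_iff start_mem_states, rule, test, tick, hp]
    rw [h, (acc_skip_of_guess hp w _ rfl).2, acc_first]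
    constructor
    · rintro (⟨n, hn⟩ | h)
      · exact ⟨n + 1, hn⟩
      · exact ⟨0, h⟩
    · rintro ⟨_ | n, h⟩
      · exact Or.inr h
      · exact Or.inl ⟨n, h⟩
  constructor
  · intro h
    have : ∃ w : List α, u = none :: (w.map some ++ [none]) := by
      cases u with
      | nil => simp [acc_iff start_mem_states, rule] at h
      | cons x u =>
        cases x with
        | some x => simp [acc_iff start_mem_states, rule, hp] at h
        | none =>
          obtain ⟨w, rfl⟩ := exists_word_of_acc_start h
          exact ⟨w, rfl⟩
    obtain ⟨w, rfl⟩ := this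
    rw [List.map_cons, List.cons_append, map_some_word, key] at h
    exact ⟨0, w, by simp, rfl, h⟩
  · rintro ⟨_, w, rfl, rfl, h⟩
    rw [← key, ← map_some_word] at h
    simpa using h

omit [Fintype α] in
theorem forall_exists_detects_iff {b : α} (hb : b ≠ C.unit) :
    (∀ w, ∃ n, C.Detects N n w) ↔ ¬ C.recur.Halts 0 N := by
  rw [← Recurrence.exists_halting_list_iff, ← not_iff_not, not_not]
  push Not
  constructor
  · rintro ⟨w, hw⟩
    refine ⟨blocks C.unit w, not_not.1 (hw 0), fun n => hw (n + 1)⟩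
  · rintro ⟨_, ⟨l, rfl⟩, h⟩
    obtain ⟨w, hw⟩ := exists_blocks_eq C.unit hb 0 (N :: l)
    refine ⟨w, fun n => ?_⟩
    cases n with
    | zero => exact not_not.2 ⟨l, hw⟩
    | succ n =>
      have := h n
      rwa [← hw] at this

theorem markedDense_of_position {p : Fin k} (hp : C.position = some p) {b : α} (hb : b ≠ C.unit)
    {ϱ : Language (Marked α) → Language (Marked α)}
    (hϱ : ϱ ∈ ({suff, infx} : Set (Language (Marked α) → Language (Marked α)))) :
    MarkedDense ϱ (C.machine N).language ↔ ¬ C.recur.Halts 0 N := by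
  rw [← forall_exists_detects_iff hb]
  rcases hϱ with rfl | rfl
  · exact markedDense_suff_iff (mem_language_of_position hp)
  · exact markedDense_infx_iff (mem_language_of_position hp)

theorem markedDense_of_guess (hp : C.position = none) {b : α} (hb : b ≠ C.unit)
    {ϱ : Language (Marked α) → Language (Marked α)}
    (hϱ : ϱ ∈ ({suff, infx, pref} : Set (Language (Marked α) → Language (Marked α)))) :
    MarkedDense ϱ (C.machine N).language ↔ ¬ C.recur.Halts 0 N := by
  rw [← forall_exists_detects_iff hb]
  have : (∀ w, ∃ n, C.Detects N n w) ↔ ∀ w, ∃ n, n = 0 ∧ ∃ m, C.Detects N m w := by simp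
  rw [this]
  rcases hϱ with rfl | rfl | rfl
  · exact markedDense_suff_iff (mem_language_of_guess hp)
  · exact markedDense_infx_iff (mem_language_of_guess hp)
  · exact markedDense_pref_iff (mem_language_of_guess hp) fun n w h => h.1

end Checker

open Turing StateTransition

/-! Turing machines as recurrences -/

section Stacks

variable {Γ : Type*} [Inhabited Γ]

/-- The number `s` in base `m` lists the symbols of `l`. -/
def Represents (m : ℕ) (e : Γ → ℕ) (s : ℕ) (l : ListBlank Γ) : Prop :=
  ∀ n, s / m ^ n % m = e (l.nth n)

variable {m : ℕ} {e : Γ → ℕ} {s : ℕ} {l : ListBlank Γ}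

theorem Represents.mod (h : Represents m e s l) : s % m = e l.head := by
  simpa using h 0

theorem Represents.div (h : Represents m e s l) : Represents m e (s / m) l.tail := by
  intro n
  rw [← ListBlank.nth_succ, ← h (n + 1), Nat.div_div_eq_div_mul, pow_succ']

theorem Represents.cons (h : Represents m e s l) {g : Γ} (hg : e g < m) :
    Represents m e (e g + m * s) (l.cons g) := by
  have hm : 0 < m := by omega
  intro n
  cases n with
  | zero => simp [Nat.mod_eq_of_lt hg]
  | succ n =>
    rw [ListBlank.nth_succ, ListBlank.tail_cons, ← h n, pow_succ', ← Nat.div_div_eq_div_mul,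
      Nat.add_mul_div_left _ _ hm, Nat.div_eq_of_lt hg, Nat.zero_add]

/-- Coding the blank by the digit `0` turns the leading zeros of a number into the infinite blank
rest of the tape. -/
theorem represents_ofDigits (he : ∀ g, e g < m) (h0 : e default = 0) (l : List Γ) :
    Represents m e (Nat.ofDigits m (l.map e)) (ListBlank.mk l) := by
  induction l with
  | nil =>
    intro n
    simp [ListBlank.nth_mk, h0]
  | cons g l ih =>
    rw [List.map_cons, Nat.ofDigits_cons, ← ListBlank.cons_mk]
    exact ih.cons (he g)

end Stacks

/-- An action on a stack. -/
inductive StackOp (Γ : Type*)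
  | keep
  | push (g : Γ)
  | pop

/-- A control state of the machine that works on two stacks in turn: a state, and either the scanned
symbol, at the start of a step (then the left stack comes next), or, in the middle of a step (then
the right stack comes next), the symbol scanned after the step and possibly a symbol to push, or
`none` if the symbol scanned after the step is on the stack. -/
abbrev Control (Γ Λ : Type*) : Type _ := Λ × Option (Γ × Option (Option Γ))

section Simulation

variable {Γ Λ : Type*} [Inhabited Γ] [Inhabited Λ] (M : TM0.Machine Γ Λ)

/-- The transition function of the machine that works on two stacks in turn, given the control state
and the top of the current stack. -/
def alternate : Control Γ Λ → Γ → Control Γ Λ × StackOp Γ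
  | (q, some (h, none)), t =>
    match M q h with
    | none => ((q, none), .keep)
    | some (q', .write g) => ((q', some (g, some none)), .keep)
    | some (q', .move .right) => ((q', none), .push h)
    | some (q', .move .left) => ((q', some (t, some (some h))), .pop)
  | (q, some (h, some none)), _ => ((q, some (h, none)), .keep)
  | (q, some (h, some (some g))), _ => ((q, some (h, none)), .push g)
  | (q, none), t => ((q, some (t, none)), .pop)

/-- An encoding of symbols and of control states over a set of states by numbers less than `m`. -/
structure Encoding (Γ Λ : Type*) [Inhabited Γ] (S : Set Λ) where
  m : ℕ
  m_pos : 0 < m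
  sym : Γ → ℕ
  symInv : ℕ → Γ
  sym_lt : ∀ g, sym g < m
  symInv_sym : ∀ g, symInv (sym g) = g
  sym_default : sym default = 0
  ctl : Control Γ Λ → ℕ
  ctlInv : ℕ → Control Γ Λ
  ctl_lt : ∀ c : Control Γ Λ, c.1 ∈ S → ctl c < m
  ctlInv_ctl : ∀ c : Control Γ Λ, c.1 ∈ S → ctlInv (ctl c) = c

theorem exists_encoding [Finite Γ] {S : Set Λ} (hS : S.Finite) : Nonempty (Encoding Γ Λ S) := by
  classical
  have := hS.to_subtype
  have hV : {c : Control Γ Λ | c.1 ∈ S}.Finite := by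
    have : {c : Control Γ Λ | c.1 ∈ S} = S ×ˢ Set.univ := by ext; simp
    rw [this]
    exact hS.prod Set.finite_univ
  have := hV.to_subtype
  obtain ⟨n, ⟨f⟩⟩ := Finite.exists_equiv_fin Γ
  obtain ⟨n', ⟨f'⟩⟩ := Finite.exists_equiv_fin {c : Control Γ Λ | c.1 ∈ S}
  have hn : 0 < n := Fin.pos (f default)
  -- The swap gives the blank the code `0`.
  let g := f.trans (Equiv.swap (f default) ⟨0, hn⟩)
  refine ⟨⟨n + n', by omega, fun x => g x, fun i => if h : i < n then g.symm ⟨i, h⟩ else default,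
    fun x => by omega, fun x => by simp, by simp [g],
    fun c => if h : c.1 ∈ S then f' ⟨c, h⟩ else 0,
    fun i => if h : i < n' then (f'.symm ⟨i, h⟩).1 else (default, none),
    fun c hc => ?_, fun c hc => ?_⟩⟩
  · simp only [hc, dif_pos]; omega
  · simp [hc]

variable {M} {S : Set Λ} (E : Encoding Γ Λ S)

namespace Encoding

variable (M)

/-- The recurrence for a Turing machine. Its members are `c + m * s` with a control state `c` and a
stack `s`, both stacks and the latest control states being found in two successive members. -/
def recurrence : Recurrence where
  m := E.m * E.m
  m_pos := Nat.mul_pos E.m_pos E.m_pos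
  coeff i j :=
    match (alternate M (E.ctlInv (j % E.m)) (E.symInv (i / E.m))).2 with
    | .keep => E.m * E.m
    | .push _ => E.m * (E.m * E.m)
    | .pop => E.m
  const i j :=
    match alternate M (E.ctlInv (j % E.m)) (E.symInv (i / E.m)) with
    | (c, .keep) => E.ctl c + E.m * (i / E.m)
    | (c, .push g) => E.ctl c + E.m * (E.sym g + E.m * (i / E.m))
    | (c, .pop) => E.ctl c
  halt _ j := ∃ q h, E.ctlInv (j % E.m) = (q, some (h, none)) ∧ M q h = none

/-- The action on stacks as numbers. -/
def apply (s : ℕ) : StackOp Γ → ℕ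
  | .keep => s
  | .push g => E.sym g + E.m * s
  | .pop => s / E.m

/-- The stack in `x` is `m * (x / m²) + top`, so each stack action is affine in `x / m²` with
coefficients depending on `top` only. Residues modulo `m²` supply `top` (from `x`) and the control
state (from the other member). -/
theorem next_eq {x s : ℕ} {c : Control Γ Λ} (hc : c.1 ∈ S) {l : ListBlank Γ}
    (hl : Represents E.m E.sym (x / E.m) l) :
    (E.recurrence M).next x (E.ctl c + E.m * s) =
      E.ctl (alternate M c l.head).1 + E.m * E.apply (x / E.m) (alternate M c l.head).2 := by
  have h1 : (E.ctl c + E.m * s) % (E.m * E.m) % E.m = E.ctl c := by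
    rw [Nat.mod_mul_right_mod, Nat.add_mul_mod_self_left, Nat.mod_eq_of_lt (E.ctl_lt c hc)]
  have h2 : x % (E.m * E.m) / E.m = E.sym l.head := by
    rw [Nat.mod_mul_right_div_self, hl.mod]
  have h3 : x / E.m = E.m * (x / (E.m * E.m)) + E.sym l.head := by
    rw [← hl.mod, ← Nat.div_div_eq_div_mul, Nat.div_add_mod]
  simp only [Recurrence.next, recurrence, h1, h2, E.ctlInv_ctl c hc, E.symInv_sym]
  rcases h : alternate M c l.head with ⟨c', _ | g | _⟩
  · simp only [apply]
    rw [h3]; ring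
  · simp only [apply]
    rw [h3]; ring
  · simp only [apply]
    rw [Nat.div_div_eq_div_mul]; ring

/-- Two successive members describe a configuration. -/
def Describes (z : ℕ × ℕ) (c : TM0.Cfg Γ Λ) : Prop :=
  c.q ∈ S ∧ Represents E.m E.sym (z.1 / E.m) c.Tape.left ∧
    ∃ s, z.2 = E.ctl (c.q, some (c.Tape.head, none)) + E.m * s ∧
      Represents E.m E.sym s c.Tape.right

omit [Inhabited Λ] in
theorem ctlInv_of_eq {c : Control Γ Λ} (hc : c.1 ∈ S) (s : ℕ) :
    E.ctlInv ((E.ctl c + E.m * s) % (E.m * E.m) % E.m) = c := by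
  rw [Nat.mod_mul_right_mod, Nat.add_mul_mod_self_left, Nat.mod_eq_of_lt (E.ctl_lt c hc),
    E.ctlInv_ctl c hc]

omit [Inhabited Λ] in
theorem div_of_eq {c : Control Γ Λ} (hc : c.1 ∈ S) (s : ℕ) :
    (E.ctl c + E.m * s) / E.m = s := by
  rw [Nat.add_mul_div_left _ _ E.m_pos, Nat.div_eq_of_lt (E.ctl_lt c hc), Nat.zero_add]

/-- A pair of successive members that halts. -/
def HaltsAt (z : ℕ × ℕ) : Prop :=
  (E.recurrence M).halt (z.1 % (E.recurrence M).m) (z.2 % (E.recurrence M).m)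

variable {M}

theorem Describes.haltsAt_iff {z : ℕ × ℕ} {c : TM0.Cfg Γ Λ} (h : E.Describes z c) :
    E.HaltsAt M z ↔ TM0.step M c = none := by
  obtain ⟨q, T⟩ := c
  obtain ⟨hq, -, s, hs, -⟩ := h
  simp only at hs hq
  simp only [HaltsAt, recurrence, hs, E.ctlInv_of_eq (c := (q, some (T.head, none))) hq, TM0.step,
    Option.map_eq_none_iff]
  constructor
  · rintro ⟨q', h', e, hM⟩
    simp only [Prod.mk.injEq, Option.some.injEq, and_true] at e
    rwa [e.1, e.2]
  · exact fun h => ⟨q, T.head, rfl, h⟩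

/-- The first new member updates the left stack, the second the right one. -/
theorem Describes.step (hM : TM0.Supports M S) {x y : ℕ} {c c' : TM0.Cfg Γ Λ}
    (h : E.Describes (x, y) c) (hc : TM0.step M c = some c') :
    ¬ E.HaltsAt M (y, (E.recurrence M).next x y) ∧
      E.Describes ((E.recurrence M).next x y,
        (E.recurrence M).next y ((E.recurrence M).next x y)) c' := by
  have hq' := TM0.step_supports M hM hc h.1
  obtain ⟨q, ⟨g, L, R⟩⟩ := c
  obtain ⟨hq, hL, s, hs, hR⟩ := h
  simp only at hs hq hL hR
  subst hs
  have hn := E.next_eq M (s := s) (c := (q, some (g, none))) hq hL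
  have hyd := E.div_of_eq (c := (q, some (g, none))) hq s
  simp only [TM0.step, Option.map_eq_some_iff] at hc
  obtain ⟨⟨q', a⟩, hMq, rfl⟩ := hc
  simp only at hq'
  -- The control state in mid-step never has the form that `halt` looks for, so the middle pair
  -- cannot halt.
  obtain ⟨c₁, hc₁, hc₁', hd₁⟩ : ∃ c₁ : Control Γ Λ, c₁.1 = q' ∧ (∀ q h, c₁ ≠ (q, some (h, none))) ∧
      c₁ = (alternate M (q, some (g, none)) L.head).1 := by
    refine ⟨_, ?_, ?_, rfl⟩ <;> rcases a with (_ | _) | g' <;> simp [alternate, hMq]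
  rw [← hd₁] at hn
  rw [hn]
  have hmem : c₁.1 ∈ S := hc₁ ▸ hq'
  refine ⟨?_, hq', ?_, ?_⟩
  · rintro ⟨q₂, h₂, e, -⟩
    rw [show (E.recurrence M).m = E.m * E.m from rfl, E.ctlInv_of_eq hmem] at e
    exact hc₁' _ _ e
  · simp only [E.div_of_eq hmem]
    rcases a with (_ | _) | g'
    · simpa [alternate, hMq, apply, Tape.move] using hL.div
    · simpa [alternate, hMq, apply, Tape.move] using hL.cons (E.sym_lt g)
    · simpa [alternate, hMq, apply, Tape.write] using hL
  · have hn' := E.next_eq M (x := E.ctl (q, some (g, none)) + E.m * s)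
      (s := E.apply (x / E.m) (alternate M (q, some (g, none)) L.head).2) hmem (l := R)
      (by rw [hyd]; exact hR)
    rw [hn', hd₁, hyd]
    rcases a with (_ | _) | g'
    · exact ⟨E.apply s (alternate M (alternate M (q, some (g, none)) L.head).1 R.head).2,
        by simp [alternate, hMq, Tape.move], by
        simpa [alternate, hMq, apply, Tape.move] using hR.cons (E.sym_lt g)⟩
    · exact ⟨E.apply s (alternate M (alternate M (q, some (g, none)) L.head).1 R.head).2,
        by simp [alternate, hMq, Tape.move], by
        simpa [alternate, hMq, apply, Tape.move] using hR.div⟩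
    · exact ⟨E.apply s (alternate M (alternate M (q, some (g, none)) L.head).1 R.head).2,
        by simp [alternate, hMq, Tape.write], by
        simpa [alternate, hMq, apply, Tape.write] using hR⟩

theorem Describes.halts_iff (hM : TM0.Supports M S) {x y : ℕ} {c : TM0.Cfg Γ Λ}
    (h : E.Describes (x, y) c) :
    (E.recurrence M).Halts x y ↔ (eval (TM0.step M) c).Dom := by
  constructor
  · rintro ⟨n, hn⟩
    induction n using Nat.strong_induction_on generalizing x y c with
    -- Strong induction, because one Turing step advances the sequence by two.
    | _ n ih =>
      rcases hc : TM0.step M c with _ | c'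
      · exact Part.dom_iff_mem.2 ⟨c, mem_eval.2 ⟨.refl, hc⟩⟩
      · obtain ⟨h1, h2⟩ := Describes.step E hM h hc
        match n with
        | 0 => exact absurd ((Describes.haltsAt_iff E h).1 hn) (by simp [hc])
        | 1 => exact absurd hn h1
        | n + 2 =>
          rw [Recurrence.seq_succ, Recurrence.seq_succ] at hn
          rw [reaches_eval (.single (show c' ∈ TM0.step M c from hc))]
          exact ih n (by omega) h2 hn
  · intro hd
    obtain ⟨b, hb'⟩ := Part.dom_iff_mem.1 hd
    obtain ⟨hr, hb⟩ := mem_eval.1 hb'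
    clear hd hb'
    induction hr using Relation.ReflTransGen.head_induction_on generalizing x y with
    | refl => exact ⟨0, (Describes.haltsAt_iff E h).2 hb⟩
    | head hc _ ih =>
      obtain ⟨-, h2⟩ := Describes.step E hM h hc
      obtain ⟨n, hn⟩ := ih h2
      refine ⟨n + 2, ?_⟩
      rwa [Recurrence.seq_succ, Recurrence.seq_succ]

end Encoding

/-- Halting of a Turing machine on inputs with a given first symbol is halting of a recurrence. -/
theorem exists_recurrence [Finite Γ] {S : Set Λ} (hS : S.Finite) (hM : TM0.Supports M S) (g : Γ) :
    ∃ (R : Recurrence) (c m : ℕ) (e : Γ → ℕ), ∀ l : List Γ,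
      R.Halts 0 (c + m * Nat.ofDigits m (l.map e)) ↔ (TM0.eval M (g :: l)).Dom := by
  obtain ⟨E⟩ := exists_encoding (Γ := Γ) hS
  -- The first member `0` is the blank left half; its control part is never read.
  refine ⟨E.recurrence M, E.ctl (default, some (g, none)), E.m, E.sym, fun l => ?_⟩
  refine (Encoding.Describes.halts_iff E hM (c := TM0.init (g :: l)) ⟨hM.1, ?_, ?_⟩).trans Iff.rfl
  · rw [Nat.zero_div]
    exact represents_ofDigits E.sym_lt E.sym_default []
  · exact ⟨_, rfl, represents_ofDigits E.sym_lt E.sym_default l⟩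

end Simulation

/-! ### From partial recursive functions to recurrences -/

theorem trNat_two_pow (n : ℕ) : PartrecToTM2.trNat (2 ^ n) =
    List.replicate n PartrecToTM2.Γ'.bit0 ++ [PartrecToTM2.Γ'.bit1] := by
  have h : ∀ n : ℕ, ∃ p : PosNum, ((2 ^ n : ℕ) : Num) = Num.pos p ∧
      PartrecToTM2.trPosNum p =
        List.replicate n PartrecToTM2.Γ'.bit0 ++ [PartrecToTM2.Γ'.bit1] := by
    intro n
    induction n with
    | zero => exact ⟨1, by rw [pow_zero, Nat.cast_one]; rfl, rfl⟩
    | succ n ih =>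
      obtain ⟨p, h1, h2⟩ := ih
      refine ⟨p.bit0, ?_, by rw [PartrecToTM2.trPosNum, h2]; rfl⟩
      rw [pow_succ, mul_two, Nat.cast_add, h1]
      exact Num.bit0_of_bit0 _
  obtain ⟨p, h1, h2⟩ := h n
  rw [PartrecToTM2.trNat, h1]
  exact h2

/-- On inputs `2 ^ n` the stack is one digit followed by `n` equal ones, so its number is an iterate
of an affine map and visibly primitive recursive in `n`. -/
theorem ofDigits_replicate (m a b n : ℕ) :
    Nat.ofDigits m (a :: List.replicate n b) = a + m * (fun x => b + m * x)^[n] 0 := by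
  rw [Nat.ofDigits_cons]
  congr 2
  induction n with
  | zero => rfl
  | succ n ih => rw [List.replicate_succ, Nat.ofDigits_cons, ih, Function.iterate_succ_apply']

/-- Halting of a stack machine on inputs with a given last symbol is halting of a recurrence. -/
theorem exists_recurrence_of_stackMachine {K : Type*} [DecidableEq K] [Finite K] {Γ : K → Type*}
    [∀ k, Finite (Γ k)] {Λ σ : Type*} [Inhabited Λ] [Inhabited σ] [Fintype σ]
    (M : Λ → TM2.Stmt Γ Λ σ) {S : Finset Λ} (hS : TM2.Supports M S) (k : K) (a : Γ k) :
    ∃ (R : Recurrence) (c m : ℕ) (e : Γ k → ℕ), ∀ l : List (Γ k),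
      R.Halts 0 (c + m * Nat.ofDigits m (l.map e)) ↔ (TM2.eval M k (l.reverse ++ [a])).Dom := by
  have h0 := TM1to0.tr_supports _ (TM2to1.tr_supports _ hS)
  have : Finite (TM2to1.Γ' K Γ) := inferInstanceAs (Finite (Bool × ∀ k, Option (Γ k)))
  obtain ⟨R, c, m, e, h⟩ := exists_recurrence (Finset.finite_toSet _) h0
    (true, Function.update (fun _ => none) k (some a))
  let sym (b : Γ k) : TM2to1.Γ' K Γ := (false, Function.update (fun _ => none) k (some b))
  refine ⟨R, c, m, e ∘ sym, fun l => ?_⟩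
  rw [← TM2to1.tr_eval_dom, ← TM1to0.tr_eval]
  -- `trInit` reverses the stack and flags its bottom, so the fixed last letter `a` becomes the
  -- fixed first tape symbol.
  have hi : TM2to1.trInit k (l.reverse ++ [a]) =
      (true, Function.update (fun _ => none) k (some a)) ::
        l.map fun b => (false, Function.update (fun _ => none) k (some b)) := by
    unfold TM2to1.trInit
    rw [List.reverse_append, List.reverse_reverse]
    rfl
  rw [hi]
  have := h (l.map sym)
  rw [List.map_map] at this
  exact this

theorem exists_recurrence_of_code (c : ToPartrec.Code) :
    ∃ (R : Recurrence) (enc : ℕ → ℕ), Primrec enc ∧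
      ∀ n, R.Halts 0 (enc n) ↔ (c.eval [2 ^ n]).Dom := by
  -- Machines start in the default label, so the default is chosen to be the entry point of `c`.
  let _ : Inhabited PartrecToTM2.Λ' := ⟨PartrecToTM2.trNormal c PartrecToTM2.Cont'.halt⟩
  have : Finite PartrecToTM2.K' := by
    refine Finite.of_surjective (![.main, .rev, .aux, .stack] : Fin 4 → PartrecToTM2.K')
      fun k => ?_
    cases k
    exacts [⟨0, rfl⟩, ⟨1, rfl⟩, ⟨2, rfl⟩, ⟨3, rfl⟩]
  obtain ⟨R, q, m, e, h⟩ := exists_recurrence_of_stackMachine _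
    (PartrecToTM2.tr_supports c PartrecToTM2.Cont'.halt) PartrecToTM2.K'.main
    PartrecToTM2.Γ'.cons
  refine ⟨R, fun n => q + m * Nat.ofDigits m (e .bit1 :: List.replicate n (e .bit0)), ?_,
    fun n => ?_⟩
  · simp only [ofDigits_replicate]
    have : Primrec fun n : ℕ => (fun x => e .bit0 + m * x)^[n] 0 :=
      Primrec.nat_iterate .id (.const 0)
        (Primrec.nat_add.comp (.const _) (Primrec.nat_mul.comp (.const _) .snd))
    exact Primrec.nat_add.comp (.const _) (Primrec.nat_mul.comp (.const _)
      (Primrec.nat_add.comp (.const _) (Primrec.nat_mul.comp (.const _) this)))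
  · have hl := h (.bit1 :: List.replicate n .bit0)
    rw [List.map_cons, List.map_replicate] at hl
    refine hl.trans ?_
    have hi : (PartrecToTM2.Γ'.bit1 :: List.replicate n .bit0).reverse ++ [.cons] =
        PartrecToTM2.trList [2 ^ n] := by
      simp [trNat_two_pow]
    rw [hi]
    have hinit : (TM2.init PartrecToTM2.K'.main (PartrecToTM2.trList [2 ^ n]) :
        PartrecToTM2.Cfg') = PartrecToTM2.init c [2 ^ n] := by
      unfold TM2.init PartrecToTM2.init
      congr 1
      funext k
      cases k <;> rfl
    change (StateTransition.eval (TM2.step PartrecToTM2.tr)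
      (TM2.init PartrecToTM2.K'.main (PartrecToTM2.trList [2 ^ n]))).Dom ↔ _
    rw [hinit, PartrecToTM2.tr_eval]
    rfl

theorem exists_recurrence_of_partrec {f : ℕ →. ℕ} (hf : Partrec f) :
    ∃ (R : Recurrence) (enc : ℕ → ℕ), Primrec enc ∧ ∀ n, R.Halts 0 (enc n) ↔ (f n).Dom := by
  -- `g` recovers the exponent, so that running `g` on `2 ^ n` amounts to running `f` on `n`.
  let g : ℕ →. ℕ := fun k => (Nat.rfind fun n => Part.some (decide (2 ^ n = k))).bind f
  have hpow : Primrec fun n : ℕ => 2 ^ n := by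
    have : Primrec fun n : ℕ => (fun x => 2 * x)^[n] 1 :=
      Primrec.nat_iterate .id (.const 1) (Primrec.nat_mul.comp (.const _) .snd)
    exact this.of_eq fun n => by
      induction n with
      | zero => rfl
      | succ n ih => rw [Function.iterate_succ_apply', ih, pow_succ']
  have hg : Partrec g := by
    refine (Partrec.rfind (p := fun k n => Part.some (decide (2 ^ n = k))) ?_).bind (hf.comp .snd)
    have : Primrec fun x : ℕ × ℕ => decide (2 ^ x.2 = x.1) :=
      Primrec.beq.comp (hpow.comp .snd) .fst
    exact this.to_comp
  have hgf : ∀ n, g (2 ^ n) = f n := by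
    intro n
    have : Nat.rfind (fun i => Part.some (decide (2 ^ i = 2 ^ n))) = Part.some n := by
      refine Part.eq_some_iff.2 (Nat.mem_rfind.2 ⟨by simp, fun {i} hi => ?_⟩)
      simp [hi.ne]
    simp only [g, this]
    exact Part.bind_some _ _
  obtain ⟨c, hc⟩ := ToPartrec.Code.exists_code
    (Nat.Partrec'.part_iff₁.2 (hg : Partrec g))
  obtain ⟨R, enc, h1, h2⟩ := exists_recurrence_of_code c
  refine ⟨R, enc, h1, fun n => ?_⟩
  have := hc ⟨[2 ^ n], rfl⟩
  rw [h2, show c.eval [2 ^ n] = _ from this, ← hgf]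
  rfl

/-- There is a recurrence with an undecidable halting problem. -/
theorem exists_undecidable_recurrence :
    ∃ (R : Recurrence) (enc : ℕ → ℕ), Primrec enc ∧
      ¬ ComputablePred fun n => R.Halts 0 (enc n) := by
  have hf : Partrec fun n : ℕ => (Denumerable.ofNat Nat.Partrec.Code n).eval 0 :=
    Nat.Partrec.Code.eval_part.comp (Primrec.ofNat _).to_comp (.const 0)
  obtain ⟨R, enc, h1, h2⟩ := exists_recurrence_of_partrec hf
  refine ⟨R, enc, h1, fun h => ComputablePred.halting_problem 0 ?_⟩
  obtain ⟨p, hp⟩ := ComputablePred.computable_iff.1 h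
  refine ComputablePred.computable_iff.2 ⟨fun c => p (Encodable.encode c), ?_, ?_⟩
  · exact hp.1.comp Computable.encode
  · funext c
    rw [← show _ = _ from congrFun hp.2 _]
    simp [h2]

/-! ### Computability of the reduction -/

theorem primrec_flatMap_const {β ι σ : Type*} [Primcodable β] [Primcodable σ] (l : List ι)
    {f : β → ι → List σ} (hf : ∀ i, Primrec fun b => f b i) :
    Primrec fun b => l.flatMap (f b) := by
  induction l with
  | nil => exact .const []
  | cons i l ih => exact Primrec.list_append.comp (hf i) ih

theorem primrec_transition {k : ℕ} {A β : Type*} [Primcodable A] [Primcodable β]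
    {f g : β → ℕ} (hf : Primrec f) (hg : Primrec g) (r : Option A) (p : Fin k → Bool) (mv : Bool)
    (ch : Fin k → SignType) :
    Primrec fun b => (⟨f b, r, p, g b, mv, ch⟩ : Transition k A) := by
  have : Primrec fun b => (Transition.equivProd k A).symm (f b, r, p, g b, mv, ch) :=
    Primrec.of_equiv_symm.comp (hf.pair ((Primrec.const r).pair ((Primrec.const p).pair
      (hg.pair (Primrec.const (mv, ch))))))
  exact this

namespace Checker

open State

variable {k : ℕ} {α : Type*} [DecidableEq α] [Fintype α] [Primcodable α] (C : Checker k α)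

omit [DecidableEq α] [Fintype α] in
theorem primrec_singleton {f g : ℕ → ℕ} (hf : Primrec f) (hg : Primrec g)
    (r : Option (Marked α)) (p : Fin k → Bool) (mv : Bool) (ch : Fin k → SignType) :
    Primrec fun n => [(⟨f n, r, p, g n, mv, ch⟩ : Transition k (Marked α))] :=
  Primrec.list_cons.comp (primrec_transition hf hg r p mv ch) (.const [])

theorem primrec_code_pre : Primrec fun n => (pre n).code :=
  Primrec₂.natPair.comp (.const 7) .id

/-- Among these states `N` occurs only in the transition from `first` to `pre N`. -/
theorem primrec_transOf_main (s : State) : Primrec fun N => transOf State.code (C.rule N) s := by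
  refine primrec_flatMap_const _ fun rp => ?_
  by_cases hs : s = first
  · subst hs
    obtain ⟨_ | _ | x, p⟩ := rp
    · exact .const _
    · exact .const _
    · by_cases hx : x = C.unit
      · simp only [rule, hx, if_true]
        exact .const _
      · simp only [rule, hx, if_false, List.map_cons, List.map_nil]
        exact primrec_singleton (.const _) primrec_code_pre _ _ _ _
  · have : ∀ N, C.rule N s rp.1 rp.2 = C.rule 0 s rp.1 rp.2 := by
      intro N
      obtain ⟨_ | _ | x, p⟩ := rp
      all_goals cases s with
        | first => exact absurd rfl hs
        | remain i j e => cases e <;> rfl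
        | _ => rfl
    simp only [this]
    exact .const _

theorem primrec_transOf_pre (N : ℕ) :
    Primrec fun j => transOf State.code (C.rule N) (pre j) := by
  refine primrec_flatMap_const _ fun rp => ?_
  obtain ⟨r, p⟩ := rp
  have hs : Primrec fun j => (succeed r : List (State × Bool × (Fin k → SignType))).map fun o =>
      (⟨(pre j).code, r, p, o.1.code, o.2.1, o.2.2⟩ : Transition k (Marked α)) := by
    rcases r with _ | _ | x
    · exact .const _
    · exact primrec_singleton primrec_code_pre (.const _) _ _ _ _
    · exact primrec_singleton primrec_code_pre (.const _) _ _ _ _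
  have h0 : PrimrecPred fun j : ℕ => j = 0 := Primrec.eq.comp .id (.const 0)
  by_cases hr : r = some (some C.unit)
  · have := Primrec.ite h0 hs (primrec_singleton (k := k) primrec_code_pre
      (primrec_code_pre.comp Primrec.pred) r p true 0)
    refine this.of_eq fun j => ?_
    by_cases hj : j = 0 <;> simp [rule, hr, hj]
  · have := Primrec.ite h0 (.const []) hs
    refine this.of_eq fun j => ?_
    by_cases hj : j = 0 <;> simp [rule, hr, hj]

theorem primrec_machine : Primrec C.machine := by
  have h1 : Primrec fun N => C.mainStates.flatMap (transOf State.code (C.rule N)) :=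
    primrec_flatMap_const _ C.primrec_transOf_main
  have h2 : Primrec fun N => (List.range (N + 1)).flatMap fun j =>
      transOf State.code (C.rule 0) (pre j) :=
    Primrec.list_flatMap (Primrec.list_range.comp Primrec.succ)
      ((C.primrec_transOf_pre 0).comp .snd)
  have h3 : Primrec fun N => (CounterMachine.equivProd k (Marked α)).symm
      (start.code, [final.code], C.mainStates.flatMap (transOf State.code (C.rule N)) ++
        (List.range (N + 1)).flatMap fun j => transOf State.code (C.rule 0) (pre j)) :=
    Primrec.of_equiv_symm.comp ((Primrec.const _).pair ((Primrec.const _).pair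
      (Primrec.list_append.comp h1 h2)))
  refine h3.of_eq fun N => ?_
  unfold machine machineOf states
  rw [List.flatMap_append, List.flatMap_map]
  -- On the states `pre j` the rules for `N` and for `0` agree by definition.
  rfl

end Checker

/-- The decider may be partial, but its composite with `f` is total because `f` takes values in `D`.
-/
theorem not_decidableOn_of_reduction {β : Type*} [Primcodable β] {D P : β → Prop} {H : ℕ → Prop}
    (hH : ¬ ComputablePred H) (f : ℕ → β) (hf : Computable f) (hD : ∀ n, D (f n))
    (hP : ∀ n, P (f n) ↔ ¬ H n) : ¬ DecidableOn D P := by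
  rintro ⟨d, hd, h⟩
  have hex : ∀ n, ∃ v ∈ d (f n), (v = true ↔ P (f n)) := fun n => h _ (hD n)
  choose v hv hv' using hex
  have hc : Computable v := (hd.comp hf).of_eq fun n => Part.eq_some_iff.2 (hv n)
  refine hH (ComputablePred.computable_iff.2 ⟨fun n => !v n, Primrec.not.to_comp.comp hc, ?_⟩)
  funext n
  rw [eq_iff_iff]
  have := (hv' n).trans (hP n)
  cases hn : v n <;> simp_all

end CounterLang

theorem proposition4 {α : Type*} [Finite α] [Nontrivial α] [Primcodable α] :
    (∀ ϱ ∈ ({CounterLang.suff, CounterLang.infx, CounterLang.pref} :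
        Set (Language (CounterLang.Marked α) → Language (CounterLang.Marked α))),
      ¬ CounterLang.DecidableOn
        (fun M : CounterLang.CounterMachine 1 (CounterLang.Marked α) => M.IsNCM 1)
        (fun M => CounterLang.MarkedDense ϱ M.language)) ∧
    (∀ ϱ ∈ ({CounterLang.suff, CounterLang.infx} :
        Set (Language (CounterLang.Marked α) → Language (CounterLang.Marked α))),
      ¬ CounterLang.DecidableOn
        (fun M : CounterLang.CounterMachine 1 (CounterLang.Marked α) => M.IsDCM 3)
        (fun M => CounterLang.MarkedDense ϱ M.language)) ∧
    (∀ ϱ ∈ ({CounterLang.suff, CounterLang.infx} :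
        Set (Language (CounterLang.Marked α) → Language (CounterLang.Marked α))),
      ¬ CounterLang.DecidableOn
        (fun M : CounterLang.CounterMachine 2 (CounterLang.Marked α) => M.IsDCM 1)
        (fun M => CounterLang.MarkedDense ϱ M.language)) := by
  classical
  have := Fintype.ofFinite α
  obtain ⟨a, b, hab⟩ := exists_pair_ne α
  obtain ⟨R, enc, henc, hR⟩ := CounterLang.exists_undecidable_recurrence
  refine ⟨fun ϱ hϱ => ?_, fun ϱ hϱ => ?_, fun ϱ hϱ => ?_⟩
  -- The block is guessed, and the only counter serves the comparison.
  · let C : CounterLang.Checker 1 α := ⟨R, a, none, 0⟩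
    exact CounterLang.not_decidableOn_of_reduction hR (fun n => C.machine (enc n))
      (C.primrec_machine.comp henc).to_comp (fun n => C.isNCM_machine (by simp [C]) _)
      fun n => CounterLang.Checker.markedDense_of_guess rfl hab.symm hϱ
  -- One counter plays both roles.
  · let C : CounterLang.Checker 1 α := ⟨R, a, some 0, 0⟩
    exact CounterLang.not_decidableOn_of_reduction hR (fun n => C.machine (enc n))
      (C.primrec_machine.comp henc).to_comp
      (fun n => C.isDCM_machine_three (fun i => Subsingleton.elim _ _) rfl _)
      fun n => CounterLang.Checker.markedDense_of_position rfl hab.symm hϱ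
  -- Each role has its own counter.
  · let C : CounterLang.Checker 2 α := ⟨R, a, some 0, 1⟩
    exact CounterLang.not_decidableOn_of_reduction hR (fun n => C.machine (enc n))
      (C.primrec_machine.comp henc).to_comp
      (fun n => C.isDCM_machine_one (by simp [C]) rfl _)
      fun n => CounterLang.Checker.markedDense_of_position rfl hab.symm hϱ
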